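/- Let $A=K[X_1,\dots,X_n]$ be a polynomial ring over a field $K$, graded by total degree. For a homogeneous ideal $I\subseteq A$ write $I_e$ for its degree $e$ part and $I_{\le d}=\bigoplus_{j\le d} I_j$; its Hilbert function is $e\mapsto\dim_K I_e$. The support of a non-zero $f\in A$ is the set of monomials that occur in $f$ with non-zero coefficient. For a subset $S\subseteq A$, the circuits set $\mathrm{cs}(S)$ is the set of all inclusion-minimal elements of $\{\mathrm{supp}(f): f\in S,\ f\neq 0\}$. For $\omega\in\mathbb R^n$, the initial form $\mathrm{in}_\omega(f)$ is the sum of the terms $\alpha X^a$ of $f$ for which $\omega\cdot a$ is maximal, and $\mathrm{in}_\omega(I)$ is the ideal generated by all $\mathrm{in}_\omega(f)$ with $f\in I$. Call $\omega,\omega'\in\mathbb R^n$ equivalent if $\mathrm{in}_\omega(I)=\mathrm{in}_{\omega'}(I)$; the Gröbner fan $\mathrm{GF}(I)$ is the collection of the closures (in the Euclidean topology of $\mathbb R^n$) of the equivalence classes. The lex-segment ideal with the same Hilbert function as $I$ is the monomial ideal generated by the monomials which, for some $e\ge 0$, are among the $\dim_K I_e$ largest monomials of degree $e$ in the lexicographic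 order with $X_1>\dots>X_n$. **Corollary.** Let $I$ and $J$ be homogeneous ideals of $A$ with the same Hilbert function, and let $d$ be the largest degree of a minimal generator of the lex-segment ideal with the same Hilbert function as $I$ and $J$ (with $d=0$ if this ideal is zero). If $\mathrm{cs}(I_{\le d})=\mathrm{cs}(J_{\le d})$, then $\mathrm{GF}(I)=\mathrm{GF}(J)$. -/

import Mathlib

attribute [local instance] MvPolynomial.gradedAlgebra

namespace CircuitSets

variable {K : Type*} [Field K] {n : ℕ}

/-- `I_e`: the `K`-vector space of homogeneous elements of degree `e` in the ideal `I`
(together with zero). -/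
noncomputable def homogeneousPart (I : Ideal (MvPolynomial (Fin n) K)) (e : ℕ) :
    Submodule K (MvPolynomial (Fin n) K) :=
  I.restrictScalars K ⊓ MvPolynomial.homogeneousSubmodule (Fin n) K e

/-- The truncation `I_{≤ d}`, the sum of the `I_j` with `j ≤ d`. -/
noncomputable def truncation (I : Ideal (MvPolynomial (Fin n) K)) (d : ℕ) :
    Submodule K (MvPolynomial (Fin n) K) :=
  ⨆ (j : ℕ) (_ : j ≤ d), homogeneousPart I j

/-- The Hilbert function `e ↦ dim_K I_e`. (Two ideals have the same function `dim_K I_e` if and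
only if they have the same function `dim_K (A/I)_e`, the spaces `A_e` being finite dimensional.) -/
noncomputable def hilbertFunction (I : Ideal (MvPolynomial (Fin n) K)) (e : ℕ) : ℕ :=
  Module.finrank K (homogeneousPart I e)

/-- The circuits set of a set of polynomials: the inclusion-minimal elements among the monomial
supports of its non-zero elements. Monomials are represented by their exponent vectors. -/
def circuits (S : Set (MvPolynomial (Fin n) K)) : Set (Finset (Fin n →₀ ℕ)) :=
  {T | Minimal (fun U => ∃ f ∈ S, f ≠ 0 ∧ f.support = U) T}

/-- The lex-segment ideal with the Hilbert function of the homogeneous ideal `I`: in each degree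
`e` take the `dim_K I_e` lexicographically largest monomials of degree `e`, where
`X_1 > X_2 > ... > X_n`. A monomial is among these if and only if fewer than `dim_K I_e` monomials
of degree `e` are lexicographically larger. -/
noncomputable def lexSegmentIdeal (I : Ideal (MvPolynomial (Fin n) K)) :
    Ideal (MvPolynomial (Fin n) K) :=
  Ideal.span {m | ∃ a : Fin n →₀ ℕ, m = MvPolynomial.monomial a (1 : K) ∧
    {b : Fin n →₀ ℕ | b.degree = a.degree ∧ toLex a < toLex b}.ncard
      < hilbertFunction I a.degree}

/-- The exponent vectors of the minimal generators of a monomial ideal `L`: the monomials of `L`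
that are minimal with respect to divisibility. -/
def minimalGenerators (L : Ideal (MvPolynomial (Fin n) K)) : Set (Fin n →₀ ℕ) :=
  {a | Minimal (fun b => MvPolynomial.monomial b (1 : K) ∈ L) a}

/-- The weight `ω · a` of the monomial with exponent vector `a`. -/
noncomputable def monomialWeight (ω : Fin n → ℝ) (a : Fin n →₀ ℕ) : ℝ :=
  ∑ i, ω i * (a i : ℝ)

open Classical in
/-- The initial form of `f`: the sum of the terms of `f` of maximal weight. -/
noncomputable def initialForm (ω : Fin n → ℝ) (f : MvPolynomial (Fin n) K) :
    MvPolynomial (Fin n) K :=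
  ∑ a ∈ f.support with ∀ b ∈ f.support, monomialWeight ω b ≤ monomialWeight ω a,
    MvPolynomial.monomial a (f.coeff a)

/-- The initial ideal of `I` with respect to the weight `ω`. -/
noncomputable def initialIdeal (ω : Fin n → ℝ) (I : Ideal (MvPolynomial (Fin n) K)) :
    Ideal (MvPolynomial (Fin n) K) :=
  Ideal.span (initialForm ω '' (I : Set (MvPolynomial (Fin n) K)))

/-- The Gröbner fan of `I`: the collection of the closures (the product topology on `Fin n → ℝ` is
the Euclidean one) of the classes of weights that give the same initial ideal. -/
def groebnerFan (I : Ideal (MvPolynomial (Fin n) K)) : Set (Set (Fin n → ℝ)) :=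
  Set.range fun ω : Fin n → ℝ => closure {ω' | initialIdeal ω' I = initialIdeal ω I}

end CircuitSets

/-! Equality of Gröbner fans follows once `I` and `J` induce the same equivalence relation on
weights. This rests on linear algebra in degrees up to `d` and on Macaulay's theorem above `d`.

In a fixed degree `e ≤ d`, order monomials by weight with lexicographic tie-break. The leading
monomials of `I_e` are the pivots of a unique reduced basis, and the supports of its elements are
circuits. The circuits determine both the pivots and these supports, so `I_e` and `J_e` have reduced
bases with the same pivots and supports. The initial forms of the reduced basis form the reduced
basis of the span of initial forms. Whether `ω` and `ω'` select the same terms depends on supports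
only, so the equality of initial spaces passes from `I_e` to `J_e`
(`initialSpan_eq_of_circuits_eq`).

An initial ideal of `J` has the Hilbert function of `J`. In degrees `e ≥ d` the lex-segment ideal
acquires no new generators, so its degree `e + 1` part is the shade of its degree `e` part.
Lex-segments have the smallest shade (`IsLexSegment.card_shade_le`), hence every ideal with this
Hilbert function is generated in degrees at most `d`, and the comparison of initial ideals up to
degree `d` suffices (`homogeneousPart_le_of_forall_le`). -/

namespace CircuitSets

open MvPolynomial

/-! ### Reduced echelon bases of spaces of polynomials -/

section ReducedBasis

variable {σ K κ : Type*} [Field K] [LinearOrder κ]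

/-- The leading monomials of the elements of `V`, monomials being compared through the key `k`. -/
def leadingMonomials (k : (σ →₀ ℕ) → κ) (V : Submodule K (MvPolynomial σ K)) : Set (σ →₀ ℕ) :=
  {b | ∃ f ∈ V, b ∈ f.support ∧ ∀ c ∈ f.support, k c ≤ k b}

/-- The family `F`, indexed by a finite set `B` of monomials, is the basis of `V` in reduced echelon
form with pivots `B`. -/
structure IsReducedBasis (V : Submodule K (MvPolynomial σ K)) (B : Finset (σ →₀ ℕ))
    (F : (σ →₀ ℕ) → MvPolynomial σ K) : Prop where
  mem : ∀ b ∈ B, F b ∈ V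
  coeff_self : ∀ b ∈ B, coeff b (F b) = 1
  coeff_ne : ∀ b ∈ B, ∀ c ∈ B, c ≠ b → coeff c (F b) = 0
  eq_zero : ∀ f ∈ V, (∀ b ∈ B, coeff b f = 0) → f = 0

namespace IsReducedBasis

variable {V W : Submodule K (MvPolynomial σ K)} {B : Finset (σ →₀ ℕ)}
  {F G : (σ →₀ ℕ) → MvPolynomial σ K}

theorem coeff_sum (h : IsReducedBasis V B F) (x : (σ →₀ ℕ) → K) {c : σ →₀ ℕ} (hc : c ∈ B) :
    coeff c (∑ b ∈ B, x b • F b) = x c := by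
  rw [MvPolynomial.coeff_sum, Finset.sum_eq_single_of_mem c hc]
  · rw [coeff_smul, h.coeff_self c hc, smul_eq_mul, mul_one]
  · intro b hb hbc
    rw [coeff_smul, h.coeff_ne b hb c hc hbc.symm, smul_zero]

theorem sum_mem (h : IsReducedBasis V B F) (x : (σ →₀ ℕ) → K) : ∑ b ∈ B, x b • F b ∈ V :=
  V.sum_mem fun b hb => V.smul_mem _ (h.mem b hb)

theorem eq_of_coeff (h : IsReducedBasis V B F) {f g : MvPolynomial σ K} (hf : f ∈ V) (hg : g ∈ V)
    (hfg : ∀ b ∈ B, coeff b f = coeff b g) : f = g :=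
  sub_eq_zero.1 <| h.eq_zero _ (V.sub_mem hf hg) fun b hb => by
    rw [coeff_sub, hfg b hb, sub_self]

theorem eq_sum (h : IsReducedBasis V B F) {f : MvPolynomial σ K} (hf : f ∈ V) :
    f = ∑ b ∈ B, coeff b f • F b :=
  h.eq_of_coeff hf (h.sum_mem _) fun _ hb => (h.coeff_sum (coeff · f) hb).symm

theorem eq_of_isReducedBasis (h : IsReducedBasis V B F) (h' : IsReducedBasis V B G)
    {b : σ →₀ ℕ} (hb : b ∈ B) : F b = G b := by
  refine h.eq_of_coeff (h.mem b hb) (h'.mem b hb) fun c hc => ?_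
  by_cases hcb : c = b
  · subst hcb
    rw [h.coeff_self c hc, h'.coeff_self c hc]
  · rw [h.coeff_ne b hb c hc hcb, h'.coeff_ne b hb c hc hcb]

theorem le_of_forall_mem (h : IsReducedBasis V B F) (hW : ∀ b ∈ B, F b ∈ W) : V ≤ W := by
  intro f hf
  rw [h.eq_sum hf]
  exact W.sum_mem fun b hb => W.smul_mem _ (hW b hb)

theorem finrank_eq (h : IsReducedBasis V B F) : Module.finrank K V = B.card := by
  let φ : V →ₗ[K] (B → K) := LinearMap.pi fun b => (lcoeff K (b : σ →₀ ℕ)).comp V.subtype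
  have hφ : Function.Bijective φ := by
    constructor
    · intro f g hfg
      exact Subtype.ext (h.eq_of_coeff f.2 g.2 fun b hb => congrFun hfg ⟨b, hb⟩)
    · intro x
      classical
      refine ⟨⟨_, h.sum_mem fun b => if hb : b ∈ B then x ⟨b, hb⟩ else 0⟩, ?_⟩
      ext b
      exact (h.coeff_sum _ b.2).trans (by simp)
  rw [(LinearEquiv.ofBijective φ hφ).finrank_eq, Module.finrank_fintype_fun_eq_card,
    Fintype.card_coe]

theorem leadingMonomials_eq (h : IsReducedBasis V B F) {k : (σ →₀ ℕ) → κ}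
    (hk : Function.Injective k) (hF : ∀ b ∈ B, ∀ c ∈ (F b).support, k c ≤ k b) :
    leadingMonomials k V = B := by
  classical
  ext b
  constructor
  · rintro ⟨f, hf, hb, hmax⟩
    have hne : (B.filter fun b => coeff b f ≠ 0).Nonempty := by
      by_contra hemp
      rw [Finset.not_nonempty_iff_eq_empty, Finset.filter_eq_empty_iff] at hemp
      have := h.eq_zero f hf fun b hb => not_not.1 (hemp hb)
      simp [this] at hb
    obtain ⟨m, hm, hmm⟩ := Finset.exists_max_image _ k hne
    rw [Finset.mem_filter] at hm
    have hle : k b ≤ k m := by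
      rw [h.eq_sum hf, mem_support_iff, MvPolynomial.coeff_sum] at hb
      obtain ⟨c, hc, hcb⟩ := Finset.exists_ne_zero_of_sum_ne_zero hb
      rw [coeff_smul, smul_eq_mul] at hcb
      exact (hF c hc b (mem_support_iff.2 (right_ne_zero_of_mul hcb))).trans
        (hmm c (Finset.mem_filter.2 ⟨hc, left_ne_zero_of_mul hcb⟩))
    rw [hk (le_antisymm hle (hmax m (mem_support_iff.2 hm.2)))]
    exact hm.1
  · intro hb
    have hb' : b ∈ B := hb
    exact ⟨F b, h.mem b hb', by simp [h.coeff_self b hb'], hF b hb'⟩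

end IsReducedBasis

/-- Gaussian elimination, by induction on the number of pivots below `b`. Only finiteness of the
pivot set is needed, so the key need not come from a well-order and weights may be negative. -/
theorem exists_isReducedBasis {k : (σ →₀ ℕ) → κ} (hk : Function.Injective k)
    {V : Submodule K (MvPolynomial σ K)} {B : Finset (σ →₀ ℕ)}
    (hB : leadingMonomials k V = B) :
    ∃ F, IsReducedBasis V B F ∧ ∀ b ∈ B, ∀ c ∈ (F b).support, k c ≤ k b := by
  classical
  have key : ∀ (m : ℕ) (b : σ →₀ ℕ), b ∈ B → (B.filter fun c => k c < k b).card = m →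
      ∃ f ∈ V, coeff b f = 1 ∧ (∀ c ∈ B, c ≠ b → coeff c f = 0) ∧
        ∀ c ∈ f.support, k c ≤ k b := by
    intro m
    induction m using Nat.strong_induction_on with
    | _ m ih =>
      intro b hb hm
      have hlt : ∀ c ∈ B.filter (fun c => k c < k b), ∃ f ∈ V, coeff c f = 1 ∧
          (∀ a ∈ B, a ≠ c → coeff a f = 0) ∧ ∀ a ∈ f.support, k a ≤ k c := by
        intro c hc
        rw [Finset.mem_filter] at hc
        refine ih _ ?_ c hc.1 rfl
        rw [← hm]
        refine Finset.card_lt_card ⟨fun a ha => ?_, fun hsub => ?_⟩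
        · rw [Finset.mem_filter] at ha ⊢
          exact ⟨ha.1, ha.2.trans hc.2⟩
        · exact lt_irrefl _ (Finset.mem_filter.1 (hsub (Finset.mem_filter.2 hc))).2
      choose! G hGV hG1 hG0 hGle using hlt
      obtain ⟨g, hgV, hgb, hgle⟩ : b ∈ leadingMonomials k V := hB ▸ hb
      rw [mem_support_iff] at hgb
      obtain ⟨f, hfV, hfb, hfle⟩ : ∃ f ∈ V, coeff b f = 1 ∧ ∀ c, k b < k c → coeff c f = 0 := by
        refine ⟨(coeff b g)⁻¹ • g, V.smul_mem _ hgV, ?_, fun c hc => ?_⟩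
        · rw [coeff_smul, smul_eq_mul, inv_mul_cancel₀ hgb]
        · have : coeff c g = 0 := by
            by_contra h0
            exact absurd (hgle c (mem_support_iff.2 h0)) (not_le.2 hc)
          rw [coeff_smul, this, smul_zero]
      have hGgt : ∀ c ∈ B.filter (fun c => k c < k b), ∀ a, k b ≤ k a → coeff a (G c) = 0 := by
        intro c hc a ha
        by_contra h0
        exact absurd (hGle c hc a (mem_support_iff.2 h0))
          (not_le.2 ((Finset.mem_filter.1 hc).2.trans_le ha))
      have hco : ∀ a, k b ≤ k a →
          coeff a (f - ∑ c ∈ B.filter (fun c => k c < k b), coeff c f • G c) = coeff a f := by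
        intro a ha
        rw [coeff_sub, MvPolynomial.coeff_sum, Finset.sum_eq_zero, sub_zero]
        intro c hc
        rw [coeff_smul, hGgt c hc a ha, smul_zero]
      -- The elements `G c` clear the pivots below `b`. Those above `b` do not occur in `f`, and the
      -- correction leaves coefficients at and above `b` untouched.
      refine ⟨f - ∑ c ∈ B.filter (fun c => k c < k b), coeff c f • G c,
        V.sub_mem hfV (V.sum_mem fun c hc => V.smul_mem _ (hGV c hc)), ?_, ?_, ?_⟩
      · rw [hco b le_rfl, hfb]
      · intro a ha hab
        rcases lt_or_gt_of_ne (hk.ne hab) with h | h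
        · have haf : a ∈ B.filter (fun c => k c < k b) := Finset.mem_filter.2 ⟨ha, h⟩
          rw [coeff_sub, MvPolynomial.coeff_sum, Finset.sum_eq_single_of_mem a haf, coeff_smul,
            hG1 a haf, smul_eq_mul, mul_one, sub_self]
          intro c hc hca
          rw [coeff_smul, hG0 c hc a ha hca.symm, smul_zero]
        · rw [hco a h.le, hfle a h]
      · intro c hc
        by_contra hlt'
        rw [mem_support_iff, hco c (not_le.1 hlt').le] at hc
        exact hc (hfle c (not_le.1 hlt'))
  have key' : ∀ b ∈ B, ∃ f ∈ V, coeff b f = 1 ∧ (∀ c ∈ B, c ≠ b → coeff c f = 0) ∧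
        ∀ c ∈ f.support, k c ≤ k b := fun b hb => key _ b hb rfl
  choose! F hFV hF1 hF0 hFle using key'
  refine ⟨F, ⟨hFV, hF1, hF0, ?_⟩, hFle⟩
  intro f hf h0
  by_contra hne
  obtain ⟨b, hb, hmax⟩ := Finset.exists_max_image f.support k (support_nonempty.2 hne)
  have hbB : b ∈ (B : Set (σ →₀ ℕ)) := hB ▸ ⟨f, hf, hb, hmax⟩
  exact (mem_support_iff.1 hb) (h0 b hbB)

end ReducedBasis

/-! ### What the circuits of a space determine -/

section Circuits

variable {K κ : Type*} [Field K] [LinearOrder κ] {n : ℕ}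
  {V W : Submodule K (MvPolynomial (Fin n) K)}

/-- Among the elements with leading monomial `b`, one with fewest terms has a circuit as support.
Thus leading monomials can be read off from the circuits. -/
theorem exists_circuit_of_mem_leadingMonomials {k : (Fin n →₀ ℕ) → κ} {b : Fin n →₀ ℕ}
    (hb : b ∈ leadingMonomials k V) :
    ∃ C ∈ circuits (V : Set (MvPolynomial (Fin n) K)), b ∈ C ∧ ∀ c ∈ C, k c ≤ k b := by
  classical
  have hex : ∃ m : ℕ, ∃ f ∈ V, b ∈ f.support ∧ (∀ c ∈ f.support, k c ≤ k b) ∧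
      f.support.card = m := by
    obtain ⟨f, hf, h1, h2⟩ := hb
    exact ⟨_, f, hf, h1, h2, rfl⟩
  obtain ⟨f, hf, hbf, hle, hcard⟩ := Nat.find_spec hex
  have hmin : ∀ g ∈ V, b ∈ g.support → ¬ g.support ⊂ f.support := by
    intro g hg hbg hss
    refine Nat.find_min hex (m := g.support.card) ?_
      ⟨g, hg, hbg, fun c hc => hle c (hss.1 hc), rfl⟩
    rw [← hcard]
    exact Finset.card_lt_card hss
  refine ⟨f.support, ⟨⟨f, hf, ?_, rfl⟩, ?_⟩, hbf, hle⟩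
  · rintro rfl
    simp at hbf
  · rintro _ ⟨g, hg, hg0, rfl⟩ hsub
    by_contra hnot
    by_cases hbg : b ∈ g.support
    · exact hmin g hg hbg ⟨hsub, hnot⟩
    · obtain ⟨a, ha⟩ := support_nonempty.2 hg0
      -- Cancelling `a` against `g`, which does not involve `b`, keeps `b` and shrinks the support
      -- of `f`.
      set h := f - (coeff a f / coeff a g) • g with hh
      have hco : ∀ c, coeff c h = coeff c f - coeff a f / coeff a g * coeff c g := by
        intro c
        rw [hh, coeff_sub, coeff_smul, smul_eq_mul]
      refine hmin h (V.sub_mem hf (V.smul_mem _ hg)) ?_ ⟨?_, ?_⟩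
      · rw [mem_support_iff, hco, notMem_support_iff.1 hbg, mul_zero, sub_zero]
        exact mem_support_iff.1 hbf
      · intro c hc
        by_contra hcf
        have hcg : c ∉ g.support := fun h => hcf (hsub h)
        rw [mem_support_iff, hco, notMem_support_iff.1 hcf, notMem_support_iff.1 hcg] at hc
        simp at hc
      · intro hfh
        have := hfh (hsub ha)
        rw [mem_support_iff, hco, div_mul_cancel₀ _ (mem_support_iff.1 ha), sub_self] at this
        exact this rfl

theorem leadingMonomials_le_of_circuits_eq {k : (Fin n →₀ ℕ) → κ}
    (h : circuits (V : Set (MvPolynomial (Fin n) K)) = circuits (W : Set (MvPolynomial (Fin n) K))) :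
    leadingMonomials k V ⊆ leadingMonomials k W := by
  intro b hb
  obtain ⟨C, hC, hbC, hle⟩ := exists_circuit_of_mem_leadingMonomials hb
  rw [h] at hC
  obtain ⟨g, hg, -, rfl⟩ := hC.1
  exact ⟨g, hg, hbC, hle⟩

theorem leadingMonomials_eq_of_circuits_eq {k : (Fin n →₀ ℕ) → κ}
    (h : circuits (V : Set (MvPolynomial (Fin n) K)) = circuits (W : Set (MvPolynomial (Fin n) K))) :
    leadingMonomials k V = leadingMonomials k W :=
  (leadingMonomials_le_of_circuits_eq h).antisymm (leadingMonomials_le_of_circuits_eq h.symm)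

namespace IsReducedBasis

variable {B : Finset (Fin n →₀ ℕ)} {F G : (Fin n →₀ ℕ) → MvPolynomial (Fin n) K}

theorem eq_smul_of_support_subset (h : IsReducedBasis V B F) {b : Fin n →₀ ℕ} (hb : b ∈ B)
    {g : MvPolynomial (Fin n) K} (hg : g ∈ V) (hsub : g.support ⊆ (F b).support) :
    g = coeff b g • F b := by
  refine h.eq_of_coeff hg (V.smul_mem _ (h.mem b hb)) fun c hc => ?_
  rw [coeff_smul, smul_eq_mul]
  by_cases hcb : c = b
  · rw [hcb, h.coeff_self b hb, mul_one]
  · have h0 := h.coeff_ne b hb c hc hcb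
    rw [h0, mul_zero]
    exact notMem_support_iff.1 fun hcg => (mem_support_iff.1 (hsub hcg)) h0

/-- An element of `V` supported inside `F b` vanishes at all pivots other than `b`, so it is a
multiple of `F b`. -/
theorem support_mem_circuits (h : IsReducedBasis V B F) {b : Fin n →₀ ℕ} (hb : b ∈ B) :
    (F b).support ∈ circuits (V : Set (MvPolynomial (Fin n) K)) := by
  refine ⟨⟨F b, h.mem b hb, ?_, rfl⟩, ?_⟩
  · intro h0
    have := h.coeff_self b hb
    simp [h0] at this
  · rintro _ ⟨g, hg, hg0, rfl⟩ hsub c hc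
    have heq := h.eq_smul_of_support_subset hb hg hsub
    have hne : coeff b g ≠ 0 := fun h0 => hg0 (by rw [heq, h0, zero_smul])
    rw [mem_support_iff, heq, coeff_smul, smul_eq_mul]
    exact mul_ne_zero hne (mem_support_iff.1 hc)

/-- The circuit of `F b` is the support of some `g` in `W`. The only pivot in it is `b`, which
forces `g` to be a multiple of `G b`. -/
theorem support_eq_of_circuits_eq (hV : IsReducedBasis V B F) (hW : IsReducedBasis W B G)
    (h : circuits (V : Set (MvPolynomial (Fin n) K)) = circuits (W : Set (MvPolynomial (Fin n) K)))
    {b : Fin n →₀ ℕ} (hb : b ∈ B) : (F b).support = (G b).support := by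
  obtain ⟨g, hg, hg0, hgs⟩ := (h ▸ hV.support_mem_circuits hb :
    (F b).support ∈ circuits (W : Set (MvPolynomial (Fin n) K))).1
  have heq : g = coeff b g • G b := by
    refine hW.eq_of_coeff hg (W.smul_mem _ (hW.mem b hb)) fun c hc => ?_
    rw [coeff_smul, smul_eq_mul]
    by_cases hcb : c = b
    · rw [hcb, hW.coeff_self b hb, mul_one]
    · rw [hW.coeff_ne b hb c hc hcb, mul_zero, ← notMem_support_iff, hgs, notMem_support_iff]
      exact hV.coeff_ne b hb c hc hcb
  have hne : coeff b g ≠ 0 := fun h0 => hg0 (by rw [heq, h0, zero_smul])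
  rw [← hgs, heq, support_smul_eq hne]

end IsReducedBasis

end Circuits

end CircuitSets

namespace CircuitSets

open MvPolynomial

/-! ### Initial forms and reduced bases -/

section InitialForms

variable {K : Type*} [Field K] {n : ℕ} {ω ω' : Fin n → ℝ}

theorem coeff_initialForm_of_maximal {f : MvPolynomial (Fin n) K} {b : Fin n →₀ ℕ}
    (hb : b ∈ f.support) (hmax : ∀ c ∈ f.support, monomialWeight ω c ≤ monomialWeight ω b)
    (a : Fin n →₀ ℕ) : coeff a (initialForm ω f) =
      if monomialWeight ω a = monomialWeight ω b then coeff a f else 0 := by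
  classical
  simp only [initialForm, MvPolynomial.coeff_sum, coeff_monomial, Finset.sum_ite_eq',
    Finset.mem_filter]
  by_cases ha : a ∈ f.support
  · refine if_congr ?_ rfl rfl
    exact ⟨fun h => le_antisymm (hmax a ha) (h.2 b hb), fun h => ⟨ha, fun c hc => h ▸ hmax c hc⟩⟩
  · rw [if_neg fun h => ha h.1, notMem_support_iff.1 ha, ite_self]

theorem initialForm_zero : initialForm ω (0 : MvPolynomial (Fin n) K) = 0 := by
  simp [initialForm]

theorem exists_maximal_weight (ω : Fin n → ℝ) {f : MvPolynomial (Fin n) K} (hf : f ≠ 0) :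
    ∃ b ∈ f.support, ∀ c ∈ f.support, monomialWeight ω c ≤ monomialWeight ω b :=
  Finset.exists_max_image _ _ (support_nonempty.2 hf)

theorem support_initialForm_subset (f : MvPolynomial (Fin n) K) :
    (initialForm ω f).support ⊆ f.support := by
  intro a ha
  by_cases hf : f = 0
  · rwa [hf, initialForm_zero, ← hf] at ha
  obtain ⟨b, hb, hmax⟩ := exists_maximal_weight ω hf
  rw [mem_support_iff, coeff_initialForm_of_maximal hb hmax] at ha
  exact mem_support_iff.2 (ite_ne_right_iff.1 ha).2

/-- The `K`-span of the initial forms of the elements of `V`. -/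
noncomputable def initialSpan (ω : Fin n → ℝ) (V : Submodule K (MvPolynomial (Fin n) K)) :
    Submodule K (MvPolynomial (Fin n) K) :=
  Submodule.span K (initialForm ω '' (V : Set (MvPolynomial (Fin n) K)))

theorem initialForm_mem_initialSpan {V : Submodule K (MvPolynomial (Fin n) K)}
    {f : MvPolynomial (Fin n) K} (hf : f ∈ V) : initialForm ω f ∈ initialSpan ω V :=
  Submodule.subset_span ⟨f, hf, rfl⟩

variable {V W : Submodule K (MvPolynomial (Fin n) K)} {B : Finset (Fin n →₀ ℕ)}
  {F G : (Fin n →₀ ℕ) → MvPolynomial (Fin n) K}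

theorem IsReducedBasis.mem_support (h : IsReducedBasis V B F) {b : Fin n →₀ ℕ} (hb : b ∈ B) :
    b ∈ (F b).support := by
  simp [h.coeff_self b hb]

/-- Taking initial forms is not additive, but in the expansion of `f` in a basis whose pivots have
maximal weight nothing of top weight cancels at the pivots: only pivots of the top weight of `f`
contribute to its initial form. -/
theorem IsReducedBasis.initialForm_eq_sum (h : IsReducedBasis V B F)
    (hF : ∀ b ∈ B, ∀ c ∈ (F b).support, monomialWeight ω c ≤ monomialWeight ω b)
    {f : MvPolynomial (Fin n) K} (hf : f ∈ V) :
    initialForm ω f = ∑ b ∈ B, coeff b (initialForm ω f) • initialForm ω (F b) := by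
  by_cases hf0 : f = 0
  · simp [hf0, initialForm_zero]
  obtain ⟨m, hm, hmax⟩ := exists_maximal_weight ω hf0
  ext a
  rw [MvPolynomial.coeff_sum, coeff_initialForm_of_maximal hm hmax]
  have hterm : ∀ b ∈ B, coeff a (coeff b (initialForm ω f) • initialForm ω (F b)) =
      if monomialWeight ω a = monomialWeight ω m then coeff b f * coeff a (F b) else 0 := by
    intro b hb
    rw [coeff_smul, smul_eq_mul, coeff_initialForm_of_maximal hm hmax,
      coeff_initialForm_of_maximal (h.mem_support hb) (hF b hb)]
    by_cases hbm : monomialWeight ω b = monomialWeight ω m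
    · rw [if_pos hbm, hbm]
      split_ifs <;> simp
    · rw [if_neg hbm, zero_mul]
      split_ifs with ham
      · by_contra hne
        have h1 := hmax b (mem_support_iff.2 (left_ne_zero_of_mul (Ne.symm hne)))
        have h2 := hF b hb a (mem_support_iff.2 (right_ne_zero_of_mul (Ne.symm hne)))
        exact hbm (le_antisymm h1 (ham ▸ h2))
      · rfl
  rw [Finset.sum_congr rfl hterm]
  split_ifs with ham
  · conv_lhs => rw [h.eq_sum hf]
    rw [MvPolynomial.coeff_sum]
    exact Finset.sum_congr rfl fun b _ => by rw [coeff_smul, smul_eq_mul]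
  · rw [Finset.sum_const_zero]

theorem IsReducedBasis.initialForm (h : IsReducedBasis V B F)
    (hF : ∀ b ∈ B, ∀ c ∈ (F b).support, monomialWeight ω c ≤ monomialWeight ω b) :
    IsReducedBasis (initialSpan ω V) B fun b => initialForm ω (F b) where
  mem b hb := initialForm_mem_initialSpan (h.mem b hb)
  coeff_self b hb := by
    rw [coeff_initialForm_of_maximal (h.mem_support hb) (hF b hb), if_pos rfl, h.coeff_self b hb]
  coeff_ne b hb c hc hcb := by
    rw [coeff_initialForm_of_maximal (h.mem_support hb) (hF b hb), h.coeff_ne b hb c hc hcb,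
      ite_self]
  eq_zero g hg h0 := by
    have hsum : g = ∑ b ∈ B, coeff b g • CircuitSets.initialForm ω (F b) := by
      clear h0
      induction hg using Submodule.span_induction with
      | mem g hg =>
        obtain ⟨f, hf, rfl⟩ := hg
        exact h.initialForm_eq_sum hF hf
      | zero => simp
      | add x y _ _ hx hy =>
        conv_lhs => rw [hx, hy]
        simp only [coeff_add, add_smul, Finset.sum_add_distrib]
      | smul r x _ hx =>
        conv_lhs => rw [hx]
        simp only [coeff_smul, smul_assoc, Finset.smul_sum]
    rw [hsum]
    exact Finset.sum_eq_zero fun b hb => by rw [h0 b hb, zero_smul]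

/-- The key that compares monomials by weight and breaks ties lexicographically. -/
noncomputable def weightLexKey (ω : Fin n → ℝ) (a : Fin n →₀ ℕ) : ℝ ×ₗ Lex (Fin n →₀ ℕ) :=
  toLex (monomialWeight ω a, toLex a)

theorem weightLexKey_injective (ω : Fin n → ℝ) : Function.Injective (weightLexKey ω) := by
  intro a b h
  exact toLex.injective (congrArg Prod.snd (toLex.injective h))

theorem monomialWeight_le_of_weightLexKey_le {a b : Fin n →₀ ℕ}
    (h : weightLexKey ω a ≤ weightLexKey ω b) : monomialWeight ω a ≤ monomialWeight ω b := by
  rcases (Prod.Lex.toLex_le_toLex).1 h with h | h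
  · exact h.le
  · exact h.1.le

theorem toLex_le_of_weightLexKey_le {a b : Fin n →₀ ℕ}
    (h : weightLexKey ω a ≤ weightLexKey ω b) (hw : monomialWeight ω a = monomialWeight ω b) :
    toLex a ≤ toLex b := by
  rcases (Prod.Lex.toLex_le_toLex).1 h with h | h
  · exact absurd hw h.ne
  · exact h.2

/-- The supports of the elements of `V` lie in a common finite set of monomials. -/
def HasFiniteSupport (V : Submodule K (MvPolynomial (Fin n) K)) : Prop :=
  ∃ E : Finset (Fin n →₀ ℕ), ∀ f ∈ V, f.support ⊆ E

theorem HasFiniteSupport.finite_leadingMonomials {κ : Type*} [LinearOrder κ]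
    (hV : HasFiniteSupport V) (k : (Fin n →₀ ℕ) → κ) : (leadingMonomials k V).Finite := by
  obtain ⟨E, hE⟩ := hV
  exact E.finite_toSet.subset fun b ⟨f, hf, hb, _⟩ => hE f hf hb

/-- A finite set of pivots of `V` that belongs to the weight `ω`, and the reduced basis. -/
theorem HasFiniteSupport.exists_weight_isReducedBasis (hV : HasFiniteSupport V) (ω : Fin n → ℝ) :
    ∃ (B : Finset (Fin n →₀ ℕ)) (F : (Fin n →₀ ℕ) → MvPolynomial (Fin n) K),
      leadingMonomials (weightLexKey ω) V = B ∧ IsReducedBasis V B F ∧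
      (∀ b ∈ B, ∀ c ∈ (F b).support, weightLexKey ω c ≤ weightLexKey ω b) := by
  have hfin := hV.finite_leadingMonomials (weightLexKey ω)
  obtain ⟨F, hF, hle⟩ := exists_isReducedBasis (weightLexKey_injective ω) hfin.coe_toFinset.symm
  exact ⟨_, F, hfin.coe_toFinset.symm, hF, hle⟩

/-- The pivots belonging to `ω` therefore depend only on the space of initial forms, so weights with
the same initial space share their pivots and reduced basis. -/
theorem leadingMonomials_initialSpan (hV : HasFiniteSupport V) (ω : Fin n → ℝ) :
    leadingMonomials toLex (initialSpan ω V) = leadingMonomials (weightLexKey ω) V := by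
  obtain ⟨B, F, hB, hF, hle⟩ := hV.exists_weight_isReducedBasis ω
  have hw := fun b hb c hc => monomialWeight_le_of_weightLexKey_le (hle b hb c hc)
  rw [hB]
  refine (hF.initialForm hw).leadingMonomials_eq toLex.injective fun b hb c hc => ?_
  rw [mem_support_iff, coeff_initialForm_of_maximal (hF.mem_support hb) (hw b hb)] at hc
  obtain ⟨h1, h2⟩ := ite_ne_right_iff.1 hc
  exact toLex_le_of_weightLexKey_le (hle b hb c (mem_support_iff.2 h2)) h1

theorem finrank_initialSpan (hV : HasFiniteSupport V) (ω : Fin n → ℝ) :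
    Module.finrank K (initialSpan ω V) = Module.finrank K V := by
  obtain ⟨B, F, -, hF, hle⟩ := hV.exists_weight_isReducedBasis ω
  rw [hF.finrank_eq, (hF.initialForm fun b hb c hc =>
    monomialWeight_le_of_weightLexKey_le (hle b hb c hc)).finrank_eq]

theorem initialSpan_eq_of_circuits_eq (hV : HasFiniteSupport V) (hW : HasFiniteSupport W)
    (h : circuits (V : Set (MvPolynomial (Fin n) K)) = circuits (W : Set (MvPolynomial (Fin n) K)))
    (hωω' : initialSpan ω V = initialSpan ω' V) : initialSpan ω W = initialSpan ω' W := by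
  obtain ⟨B, F, hB, hF, hle⟩ := hV.exists_weight_isReducedBasis ω
  obtain ⟨B', F', hB', hF', hle'⟩ := hV.exists_weight_isReducedBasis ω'
  obtain ⟨C, G, hC, hG, -⟩ := hW.exists_weight_isReducedBasis ω
  obtain rfl : B = B' := by
    rw [← Finset.coe_inj, ← hB, ← hB', ← leadingMonomials_initialSpan hV, hωω',
      leadingMonomials_initialSpan hV]
  obtain rfl : B = C := by
    rw [← Finset.coe_inj, ← hB, ← hC, leadingMonomials_eq_of_circuits_eq h]
  have hw : ∀ b ∈ B, ∀ c ∈ (F b).support, monomialWeight ω c ≤ monomialWeight ω b :=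
    fun b hb c hc => monomialWeight_le_of_weightLexKey_le (hle b hb c hc)
  have hw' : ∀ b ∈ B, ∀ c ∈ (F b).support, monomialWeight ω' c ≤ monomialWeight ω' b := by
    intro b hb c hc
    rw [hF.eq_of_isReducedBasis hF' hb] at hc
    exact monomialWeight_le_of_weightLexKey_le (hle' b hb c hc)
  have hsupp : ∀ b ∈ B, (F b).support = (G b).support :=
    fun b hb => hF.support_eq_of_circuits_eq hG h hb
  have hGw : ∀ b ∈ B, ∀ c ∈ (G b).support, monomialWeight ω c ≤ monomialWeight ω b :=
    fun b hb c hc => hw b hb c (hsupp b hb ▸ hc)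
  have hGw' : ∀ b ∈ B, ∀ c ∈ (G b).support, monomialWeight ω' c ≤ monomialWeight ω' b :=
    fun b hb c hc => hw' b hb c (hsupp b hb ▸ hc)
  have hinF : ∀ b ∈ B, initialForm ω (F b) = initialForm ω' (F b) := fun b hb =>
    (hF.initialForm hw).eq_of_isReducedBasis (hωω' ▸ hF.initialForm hw') hb
  have hinG : ∀ b ∈ B, initialForm ω (G b) = initialForm ω' (G b) := by
    intro b hb
    ext a
    rw [coeff_initialForm_of_maximal (hG.mem_support hb) (hGw b hb),
      coeff_initialForm_of_maximal (hG.mem_support hb) (hGw' b hb)]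
    by_cases ha : coeff a (G b) = 0
    · rw [ha, ite_self, ite_self]
    · have haF : coeff a (F b) ≠ 0 := by
        rwa [← mem_support_iff, hsupp b hb, mem_support_iff]
      have := congrArg (coeff a) (hinF b hb)
      rw [coeff_initialForm_of_maximal (hF.mem_support hb) (hw b hb),
        coeff_initialForm_of_maximal (hF.mem_support hb) (hw' b hb)] at this
      -- At a monomial of the common support, the equality for `F b` says that it has top weight for
      -- `ω` if and only if it does for `ω'`.
      split_ifs at this ⊢ <;> first | rfl | exact absurd this haF | exact absurd this.symm haF
  refine le_antisymm ((hG.initialForm hGw).le_of_forall_mem fun b hb => ?_)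
    ((hG.initialForm hGw').le_of_forall_mem fun b hb => ?_)
  · rw [hinG b hb]
    exact initialForm_mem_initialSpan (hG.mem b hb)
  · rw [← hinG b hb]
    exact initialForm_mem_initialSpan (hG.mem b hb)

end InitialForms

end CircuitSets

namespace CircuitSets

open Finsupp

/-! ### Monomials, shades and lex-segments -/

section Macaulay

variable {σ : Type*} [LinearOrder σ]

/-- The exponent vectors of degree `e` in the variables from `s`. -/
def monomials (s : Finset σ) (e : ℕ) : Finset (σ →₀ ℕ) :=
  s.finsuppAntidiag e

theorem mem_monomials {s : Finset σ} {e : ℕ} {a : σ →₀ ℕ} :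
    a ∈ monomials s e ↔ a.degree = e ∧ a.support ⊆ s := by
  rw [monomials, Finset.mem_finsuppAntidiag]
  refine and_congr_left fun h => ?_
  rw [degree_apply, Finset.sum_subset h]
  intro i _ hi
  exact notMem_support_iff.1 hi

theorem monomials_mono {s t : Finset σ} (h : s ⊆ t) (e : ℕ) : monomials s e ⊆ monomials t e :=
  Finset.finsuppAntidiag_mono h e

theorem add_single_mem_monomials {s : Finset σ} {e c : ℕ} {a : σ →₀ ℕ} {i : σ}
    (ha : a ∈ monomials s e) (hi : i ∈ s) : a + single i c ∈ monomials s (e + c) := by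
  rw [mem_monomials] at ha ⊢
  refine ⟨by rw [map_add, degree_single, ha.1], fun j hj => ?_⟩
  by_cases hji : j = i
  · exact hji ▸ hi
  · refine ha.2 ?_
    simpa [Finsupp.single_apply, Ne.symm hji] using hj

theorem mem_monomials_of_add_single {s : Finset σ} {e c : ℕ} {a : σ →₀ ℕ} {i : σ}
    (ha : a + single i c ∈ monomials s (e + c)) : a ∈ monomials s e := by
  rw [mem_monomials] at ha ⊢
  refine ⟨by simpa using ha.1, fun j hj => ha.2 ?_⟩
  rw [mem_support_iff] at hj ⊢
  rw [Finsupp.add_apply]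
  lia

theorem mem_monomials_of_insert {s : Finset σ} {ℓ : σ} {e : ℕ} {a : σ →₀ ℕ}
    (ha : a ∈ monomials (insert ℓ s) e) (h0 : a ℓ = 0) : a ∈ monomials s e := by
  rw [mem_monomials] at ha ⊢
  refine ⟨ha.1, fun j hj => ?_⟩
  refine Finset.mem_of_mem_insert_of_ne (ha.2 hj) ?_
  rintro rfl
  exact mem_support_iff.1 hj h0

theorem eq_zero_of_mem_monomials {s : Finset σ} {ℓ : σ} {e : ℕ} {a : σ →₀ ℕ}
    (ha : a ∈ monomials s e) (hℓ : ℓ ∉ s) : a ℓ = 0 :=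
  notMem_support_iff.1 fun h => hℓ ((mem_monomials.1 ha).2 h)

/-- The multiples of the monomials in `S` by the variables in `s`. -/
noncomputable def shade (s : Finset σ) (S : Finset (σ →₀ ℕ)) : Finset (σ →₀ ℕ) :=
  Finset.image₂ (fun a i => a + single i 1) S s

theorem mem_shade {s : Finset σ} {S : Finset (σ →₀ ℕ)} {b : σ →₀ ℕ} :
    b ∈ shade s S ↔ ∃ a ∈ S, ∃ i ∈ s, a + single i 1 = b :=
  Finset.mem_image₂

theorem add_single_mem_shade {s : Finset σ} {S : Finset (σ →₀ ℕ)} {a : σ →₀ ℕ} {i : σ}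
    (ha : a ∈ S) (hi : i ∈ s) : a + single i 1 ∈ shade s S :=
  mem_shade.2 ⟨a, ha, i, hi, rfl⟩

theorem shade_mono {s t : Finset σ} {S T : Finset (σ →₀ ℕ)} (hs : s ⊆ t) (hS : S ⊆ T) :
    shade s S ⊆ shade t T :=
  Finset.image₂_subset hS hs

theorem shade_subset_monomials {s : Finset σ} {e : ℕ} {S : Finset (σ →₀ ℕ)}
    (hS : S ⊆ monomials s e) : shade s S ⊆ monomials s (e + 1) := by
  intro b hb
  obtain ⟨a, ha, i, hi, rfl⟩ := mem_shade.1 hb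
  exact add_single_mem_monomials (hS ha) hi

/-- `L` consists of the lexicographically largest monomials of degree `e` in the variables `s`. -/
structure IsLexSegment (s : Finset σ) (e : ℕ) (L : Finset (σ →₀ ℕ)) : Prop where
  subset : L ⊆ monomials s e
  mem_of_le : ∀ a ∈ L, ∀ b ∈ monomials s e, toLex a ≤ toLex b → b ∈ L

theorem IsLexSegment.subset_of_card_le {s : Finset σ} {e : ℕ} {L M : Finset (σ →₀ ℕ)}
    (hL : IsLexSegment s e L) (hM : IsLexSegment s e M) (h : L.card ≤ M.card) : L ⊆ M := by
  intro a ha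
  by_contra haM
  have hML : M ⊆ L := fun b hb => by
    rcases le_total (toLex a) (toLex b) with hab | hba
    · exact hL.mem_of_le a ha b (hM.subset hb) hab
    · exact absurd (hM.mem_of_le b hb a (hL.subset ha) hba) haM
  exact haM (Finset.eq_of_subset_of_card_le hML h ▸ ha)

theorem exists_isLexSegment (s : Finset σ) (e : ℕ) {t : ℕ} (ht : t ≤ (monomials s e).card) :
    ∃ L, IsLexSegment s e L ∧ L.card = t := by
  induction ht using Nat.decreasingInduction with
  | self => exact ⟨_, ⟨subset_rfl, fun _ _ b hb _ => hb⟩, rfl⟩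
  | of_succ t _ ih =>
    obtain ⟨L, hL, hcard⟩ := ih
    obtain ⟨m, hm, hmin⟩ := Finset.exists_min_image L toLex (Finset.card_pos.1 (by lia))
    refine ⟨L.erase m, ⟨(Finset.erase_subset _ _).trans hL.subset, fun a ha b hb hab => ?_⟩, ?_⟩
    · rw [Finset.mem_erase] at ha ⊢
      refine ⟨?_, hL.mem_of_le a ha.2 b hb hab⟩
      rintro rfl
      exact ha.1 (toLex.injective (le_antisymm hab (hmin a ha.2)))
    · rw [Finset.card_erase_of_mem hm, hcard, Nat.add_sub_cancel]

/-- If `b` only involves variables up to `m`, then a lexicographically larger monomial of the same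
degree differs from `b` for the first time before `m`. -/
theorem exists_lt_of_toLex_lt {b c : σ →₀ ℕ} {m : σ} (hdeg : b.degree = c.degree)
    (hb : ∀ j ∈ b.support, j ≤ m) (h : toLex b < toLex c) :
    ∃ p < m, (∀ q < p, b q = c q) ∧ b p < c p := by
  obtain ⟨p, hpq, hp⟩ := Finsupp.Lex.lt_iff.1 h
  refine ⟨p, ?_, hpq, hp⟩
  by_contra hmp
  rw [not_lt] at hmp
  have h1 : b ≤ c := by
    intro j
    rcases lt_trichotomy j p with hj | rfl | hj
    · exact (hpq j hj).le
    · exact hp.le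
    · have : b j = 0 := notMem_support_iff.1 fun hjb => absurd (hb j hjb) (not_le.2 (hmp.trans_lt hj))
      exact this ▸ Nat.zero_le _
  obtain ⟨x, rfl⟩ := exists_add_of_le h1
  rw [map_add] at hdeg
  have hx : x = 0 := (degree_eq_zero_iff x).1 (by lia)
  simp [hx] at hp

/-- If a monomial is at least `a * X_i`, then it stays at least `a` after division by its
last variable. -/
theorem toLex_le_of_add_single_le {a b : σ →₀ ℕ} {i j : σ}
    (hdeg : (b + single j 1).degree = (a + single i 1).degree)
    (hj : ∀ q ∈ (b + single j 1).support, q ≤ j)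
    (h : toLex (a + single i 1) ≤ toLex (b + single j 1)) : toLex a ≤ toLex b := by
  suffices hs : toLex (a + single j 1) ≤ toLex (b + single j 1) by
    rw [toLex_add, toLex_add] at hs
    exact le_of_add_le_add_right hs
  -- Variables of larger index are lexicographically smaller. If `i ≤ j`, exchanging `X_i` for `X_j`
  -- lowers the left side. Otherwise a violation would first show before `j`, where this exchange
  -- has no effect.
  rcases le_or_gt i j with hij | hji
  · refine le_trans ?_ h
    rw [toLex_add, toLex_add]
    exact add_le_add_right (Finsupp.Lex.single_le_iff.2 hij) _
  · by_contra hlt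
    rw [not_le] at hlt
    obtain ⟨p, hpj, hpq, hp⟩ := exists_lt_of_toLex_lt (m := j)
      (by simpa using hdeg) hj hlt
    refine absurd h (not_le.2 (Finsupp.Lex.lt_iff.2 ⟨p, fun q hq => ?_, ?_⟩))
    · have h1 := hpq q hq
      have hqi : i ≠ q := ((hq.trans hpj).trans hji).ne'
      have hqj : j ≠ q := (hq.trans hpj).ne'
      simp only [Finsupp.add_apply, single_apply, if_neg hqj] at h1
      simpa [single_apply, hqi, hqj] using h1
    · have hqi : i ≠ p := (hpj.trans hji).ne'
      have hqj : j ≠ p := hpj.ne'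
      simp only [Finsupp.add_apply, single_apply, if_neg hqj] at hp
      simpa [single_apply, hqi, hqj] using hp

theorem IsLexSegment.mem_of_add_single {s : Finset σ} {e : ℕ} {L : Finset (σ →₀ ℕ)}
    (hL : IsLexSegment s e L) {a b : σ →₀ ℕ} {i j : σ} (ha : a ∈ L) (hi : i ∈ s)
    (hb : b + single j 1 ∈ monomials s (e + 1)) (hj : ∀ q ∈ (b + single j 1).support, q ≤ j)
    (h : toLex (a + single i 1) ≤ toLex (b + single j 1)) : b ∈ L := by
  refine hL.mem_of_le a ha b (mem_monomials_of_add_single hb) (toLex_le_of_add_single_le ?_ hj h)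
  rw [(mem_monomials.1 hb).1, (mem_monomials.1 (add_single_mem_monomials (hL.subset ha) hi)).1]

/-- Dividing a monomial above `a * X_i` by its last variable leaves a monomial that is at least `a`,
hence in `L`. -/
theorem IsLexSegment.shade {s : Finset σ} {e : ℕ} {L : Finset (σ →₀ ℕ)}
    (hL : IsLexSegment s e L) : IsLexSegment s (e + 1) (shade s L) := by
  refine ⟨shade_subset_monomials hL.subset, fun c hc b hb hcb => ?_⟩
  obtain ⟨a, ha, i, hi, rfl⟩ := mem_shade.1 hc
  have hne : b.support.Nonempty := by
    rw [Finset.nonempty_iff_ne_empty, Ne, support_eq_empty]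
    rintro rfl
    simpa using (mem_monomials.1 hb).1
  obtain ⟨j, hjb, hj⟩ := Finset.exists_max_image b.support id hne
  obtain ⟨b, rfl⟩ : ∃ b', b = b' + single j 1 :=
    ⟨b - single j 1, (tsub_add_cancel_of_le (single_le_iff.2
      (Nat.one_le_iff_ne_zero.2 (mem_support_iff.1 hjb)))).symm⟩
  refine add_single_mem_shade (hL.mem_of_add_single ha hi hb hj hcb)
    ((mem_monomials.1 hb).2 hjb)

/-- The map on monomials that replaces the variable `ℓ` by the variable `i`. -/
noncomputable def replaceVar (ℓ i : σ) : (σ →₀ ℕ) →+ (σ →₀ ℕ) :=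
  mapDomain.addMonoidHom (Function.update id ℓ i)

theorem replaceVar_single_self (ℓ i : σ) (c : ℕ) : replaceVar ℓ i (single ℓ c) = single i c := by
  simp [replaceVar, mapDomain_single]

theorem replaceVar_single_of_ne {ℓ i j : σ} (h : j ≠ ℓ) (c : ℕ) :
    replaceVar ℓ i (single j c) = single j c := by
  simp [replaceVar, mapDomain_single, Function.update_of_ne h]

theorem replaceVar_of_eq_zero {ℓ i : σ} {a : σ →₀ ℕ} (h : a ℓ = 0) : replaceVar ℓ i a = a := by
  rw [replaceVar, mapDomain.addMonoidHom_apply]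
  conv_rhs => rw [← mapDomain_id (v := a)]
  refine mapDomain_congr fun x hx => Function.update_of_ne ?_ _ _
  rintro rfl
  exact mem_support_iff.1 hx h

theorem exists_eq_add_single {τ : Type*} (ℓ : τ) (a : τ →₀ ℕ) : ∃ b, b ℓ = 0 ∧ a = b + single ℓ (a ℓ) :=
  ⟨a.erase ℓ, erase_same, (erase_add_single ℓ a).symm⟩

theorem replaceVar_add_single {ℓ i : σ} {b : σ →₀ ℕ} (h : b ℓ = 0) (c : ℕ) :
    replaceVar ℓ i (b + single ℓ c) = b + single i c := by
  rw [map_add, replaceVar_single_self, replaceVar_of_eq_zero h]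

theorem degree_replaceVar (ℓ i : σ) (a : σ →₀ ℕ) : (replaceVar ℓ i a).degree = a.degree :=
  degree_mapDomain _ _

theorem eq_of_replaceVar_eq {ℓ i : σ} {a b : σ →₀ ℕ} (h : replaceVar ℓ i a = replaceVar ℓ i b)
    (hℓ : a ℓ = b ℓ) : a = b := by
  obtain ⟨a', ha0, ha⟩ := exists_eq_add_single ℓ a
  obtain ⟨b', hb0, hb⟩ := exists_eq_add_single ℓ b
  rw [ha, hb, replaceVar_add_single ha0, replaceVar_add_single hb0, hℓ] at h
  rw [ha, hb, hℓ, add_right_cancel h]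

theorem replaceVar_mem_monomials {s : Finset σ} {e : ℕ} {ℓ i : σ} (hi : i ∈ s)
    {a : σ →₀ ℕ} (ha : a ∈ monomials (insert ℓ s) e) : replaceVar ℓ i a ∈ monomials s e := by
  rw [mem_monomials] at ha ⊢
  refine ⟨by rw [degree_replaceVar, ha.1], fun q hq => ?_⟩
  obtain ⟨p, hp, rfl⟩ := Finset.mem_image.1 (mapDomain_support hq)
  by_cases hpℓ : p = ℓ
  · rwa [hpℓ, Function.update_self]
  · rw [Function.update_of_ne hpℓ]
    exact Finset.mem_of_mem_insert_of_ne (ha.2 hp) hpℓ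

end Macaulay

end CircuitSets

/-! ### Compression of sets of monomials -/

namespace CircuitSets

open Finsupp

/-- The elements of `A` outside the initial segment are at least `A.card`, and the equally many
missing elements are smaller. -/
theorem sum_range_card_lt {A : Finset ℕ} (h : A ≠ Finset.range A.card) :
    ∑ x ∈ Finset.range A.card, x < ∑ x ∈ A, x := by
  set R := Finset.range A.card with hR
  have hcard : (A \ R).card = (R \ A).card := Finset.card_sdiff_comm (by simp [hR])
  have hne : (R \ A).Nonempty := by
    rw [Finset.nonempty_iff_ne_empty, Ne, Finset.sdiff_eq_empty_iff_subset]
    exact fun hsub => h (Finset.eq_of_subset_of_card_le hsub (by simp [hR])).symm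
  rw [← Finset.sum_inter_add_sum_sdiff A R, ← Finset.sum_inter_add_sum_sdiff R A, Finset.inter_comm R]
  refine Nat.add_lt_add_left ?_ _
  calc ∑ x ∈ R \ A, x < ∑ _x ∈ R \ A, A.card :=
        Finset.sum_lt_sum_of_nonempty hne fun x hx =>
          Finset.mem_range.1 (Finset.mem_sdiff.1 hx).1
    _ = (A \ R).card • A.card := by rw [Finset.sum_const, hcard]
    _ ≤ ∑ x ∈ A \ R, x := Finset.card_nsmul_le_sum _ _ _ fun x hx => by
        simpa [hR] using (Finset.mem_sdiff.1 hx).2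

theorem sum_range_card_le (A : Finset ℕ) : ∑ x ∈ Finset.range A.card, x ≤ ∑ x ∈ A, x := by
  by_cases h : A = Finset.range A.card
  · rw [← h]
  · exact (sum_range_card_lt h).le

section Compression

variable {σ : Type*} [LinearOrder σ] {s : Finset σ} {e : ℕ} {ℓ i : σ} {S : Finset (σ →₀ ℕ)}

/-- The elements of `S` that become `ρ` when the variable `ℓ` is replaced by `i`. -/
noncomputable def replaceFiber (ℓ i : σ) (S : Finset (σ →₀ ℕ)) (ρ : σ →₀ ℕ) : Finset (σ →₀ ℕ) :=
  S.filter fun a => replaceVar ℓ i a = ρ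

theorem mem_replaceFiber {ρ a : σ →₀ ℕ} :
    a ∈ replaceFiber ℓ i S ρ ↔ a ∈ S ∧ replaceVar ℓ i a = ρ :=
  Finset.mem_filter

theorem injOn_replaceFiber (S : Finset (σ →₀ ℕ)) (ρ : σ →₀ ℕ) :
    Set.InjOn (fun a : σ →₀ ℕ => a ℓ) (replaceFiber ℓ i S ρ) := fun _ ha _ hb hab =>
  eq_of_replaceVar_eq ((mem_replaceFiber.1 ha).2.trans (mem_replaceFiber.1 hb).2.symm) hab

/-- The compression of `S` in direction of the variables `ℓ` and `i`: each fibre of `S` is replaced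
by equally many monomials of lowest possible degree in `ℓ`. -/
noncomputable def compress (s : Finset σ) (e : ℕ) (ℓ i : σ) (S : Finset (σ →₀ ℕ)) :
    Finset (σ →₀ ℕ) :=
  (monomials (insert ℓ s) e).filter fun b => b ℓ < (replaceFiber ℓ i S (replaceVar ℓ i b)).card

theorem image_replaceFiber_compress (hi : i ∈ s) (hℓ : ℓ ∉ s)
    (hS : S ⊆ monomials (insert ℓ s) e) (ρ : σ →₀ ℕ) :
    (replaceFiber ℓ i (compress s e ℓ i S) ρ).image (fun a => a ℓ) =
      Finset.range (replaceFiber ℓ i S ρ).card := by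
  ext j
  rw [Finset.mem_image, Finset.mem_range]
  constructor
  · rintro ⟨b, hb, rfl⟩
    obtain ⟨hbS, rfl⟩ := mem_replaceFiber.1 hb
    exact (Finset.mem_filter.1 hbS).2
  · intro hj
    obtain ⟨a, ha⟩ := Finset.card_pos.1 (Nat.zero_lt_of_lt hj)
    have hρ : ρ ∈ monomials s e := by
      rw [mem_replaceFiber] at ha
      exact ha.2 ▸ replaceVar_mem_monomials hi (hS ha.1)
    -- An element of the fibre is fixed by its `ℓ`-exponent, which lies between `0` and `ρ i`.
    have hle : (replaceFiber ℓ i S ρ).card ≤ ρ i + 1 := by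
      rw [← Finset.card_range (ρ i + 1)]
      refine Finset.card_le_card_of_injOn _ (fun x hx => ?_) (injOn_replaceFiber S ρ)
      obtain ⟨y, hy0, hy⟩ := exists_eq_add_single ℓ x
      have h2 := (mem_replaceFiber.1 hx).2
      rw [hy, replaceVar_add_single hy0] at h2
      rw [← h2, Finset.coe_range, Set.mem_Iio, Finsupp.add_apply, single_eq_same]
      lia
    have hji : j ≤ ρ i := by lia
    obtain ⟨b, rfl⟩ := exists_add_of_le (single_le_iff.2 hji)
    rw [add_comm] at hρ hj ⊢
    have hje : j ≤ e := by
      rw [← (mem_monomials.1 hρ).1, map_add, degree_single]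
      exact Nat.le_add_left _ _
    obtain ⟨k, rfl⟩ := Nat.exists_eq_add_of_le' hje
    have hb := mem_monomials_of_add_single hρ
    have hb0 := eq_zero_of_mem_monomials hb hℓ
    refine ⟨b + single ℓ j, mem_replaceFiber.2 ⟨Finset.mem_filter.2 ⟨?_, ?_⟩,
      replaceVar_add_single hb0 j⟩, by simp [hb0]⟩
    · exact add_single_mem_monomials (monomials_mono (Finset.subset_insert _ _) _ hb)
        (Finset.mem_insert_self _ _)
    · rw [replaceVar_add_single hb0]
      simpa [hb0] using hj

theorem card_replaceFiber_compress (hi : i ∈ s) (hℓ : ℓ ∉ s)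
    (hS : S ⊆ monomials (insert ℓ s) e) (ρ : σ →₀ ℕ) :
    (replaceFiber ℓ i (compress s e ℓ i S) ρ).card = (replaceFiber ℓ i S ρ).card := by
  rw [← Finset.card_image_of_injOn (injOn_replaceFiber _ ρ), image_replaceFiber_compress hi hℓ hS,
    Finset.card_range]

theorem card_eq_sum_card_replaceFiber (hi : i ∈ s) (hS : S ⊆ monomials (insert ℓ s) e) :
    S.card = ∑ ρ ∈ monomials s e, (replaceFiber ℓ i S ρ).card :=
  Finset.card_eq_sum_card_fiberwise fun _ ha => replaceVar_mem_monomials hi (hS ha)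

theorem compress_subset : compress s e ℓ i S ⊆ monomials (insert ℓ s) e :=
  Finset.filter_subset _ _

theorem card_compress (hi : i ∈ s) (hℓ : ℓ ∉ s) (hS : S ⊆ monomials (insert ℓ s) e) :
    (compress s e ℓ i S).card = S.card := by
  rw [card_eq_sum_card_replaceFiber hi hS, card_eq_sum_card_replaceFiber hi compress_subset]
  exact Finset.sum_congr rfl fun ρ _ => card_replaceFiber_compress hi hℓ hS ρ

theorem card_replaceFiber_le_shade {j : σ} (hj : j ∈ insert ℓ s) (a : σ →₀ ℕ) :
    (replaceFiber ℓ i S (replaceVar ℓ i a)).card ≤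
      (replaceFiber ℓ i (shade (insert ℓ s) S) (replaceVar ℓ i (a + single j 1))).card := by
  refine Finset.card_le_card_of_injOn (· + single j 1) (fun x hx => ?_)
    (add_left_injective _).injOn
  obtain ⟨hx, hxa⟩ := mem_replaceFiber.1 hx
  exact mem_replaceFiber.2 ⟨add_single_mem_shade hx hj, by rw [map_add, map_add, hxa]⟩

/-- Multiplying the fibre by `ℓ` keeps its size, and the element of lowest `ℓ`-exponent times `i` is
a new member. -/
theorem card_replaceFiber_lt_shade (hi : i ∈ s) (hℓ : ℓ ∉ s) (a : σ →₀ ℕ)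
    (hne : (replaceFiber ℓ i S (replaceVar ℓ i a)).Nonempty) :
    (replaceFiber ℓ i S (replaceVar ℓ i a)).card <
      (replaceFiber ℓ i (shade (insert ℓ s) S) (replaceVar ℓ i (a + single ℓ 1))).card := by
  have hiℓ : i ≠ ℓ := fun h => hℓ (h ▸ hi)
  obtain ⟨x, hx, hmin⟩ := Finset.exists_min_image _ (fun a : σ →₀ ℕ => a ℓ) hne
  rw [← Finset.card_image_of_injective _ (add_left_injective (single ℓ 1))]
  refine Finset.card_lt_card ((Finset.ssubset_iff_of_subset fun y hy => ?_).2
    ⟨x + single i 1, ?_, fun hxi => ?_⟩)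
  · obtain ⟨z, hz, rfl⟩ := Finset.mem_image.1 hy
    obtain ⟨hz, hza⟩ := mem_replaceFiber.1 hz
    exact mem_replaceFiber.2 ⟨add_single_mem_shade hz (Finset.mem_insert_self _ _),
      by rw [map_add, map_add, hza]⟩
  · obtain ⟨hx, hxa⟩ := mem_replaceFiber.1 hx
    exact mem_replaceFiber.2 ⟨add_single_mem_shade hx (Finset.mem_insert_of_mem hi),
      by rw [map_add, map_add, hxa, replaceVar_single_self, replaceVar_single_of_ne hiℓ]⟩
  · obtain ⟨z, hz, hzx⟩ := Finset.mem_image.1 hxi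
    have h1 := DFunLike.congr_fun hzx ℓ
    have h2 := hmin z hz
    simp only [Finsupp.add_apply, single_eq_same, single_eq_of_ne hiℓ.symm] at h1
    lia

/-- Fibrewise, each `ℓ`-exponent in the compressed shade is below the size of the fibre of the
original shade: multiplication by `ℓ` raises the exponent by one but enlarges the fibre, other
variables do not change the exponent. -/
theorem card_shade_compress_le (hi : i ∈ s) (hℓ : ℓ ∉ s) (hS : S ⊆ monomials (insert ℓ s) e) :
    (shade (insert ℓ s) (compress s e ℓ i S)).card ≤ (shade (insert ℓ s) S).card := by
  rw [card_eq_sum_card_replaceFiber hi (shade_subset_monomials hS),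
    card_eq_sum_card_replaceFiber hi (shade_subset_monomials compress_subset)]
  refine Finset.sum_le_sum fun ρ _ => ?_
  rw [← Finset.card_range (replaceFiber ℓ i (shade (insert ℓ s) S) ρ).card]
  refine Finset.card_le_card_of_injOn _ (fun b hb => ?_) (injOn_replaceFiber _ ρ)
  obtain ⟨hbS, rfl⟩ := mem_replaceFiber.1 hb
  obtain ⟨a, ha, j, hj, rfl⟩ := mem_shade.1 hbS
  have hlt := (Finset.mem_filter.1 ha).2
  rw [Finset.coe_range, Set.mem_Iio, Finsupp.add_apply]
  by_cases hjℓ : j = ℓ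
  · subst hjℓ
    have := card_replaceFiber_lt_shade (S := S) hi hℓ a (Finset.card_pos.1 (Nat.zero_lt_of_lt hlt))
    rw [single_eq_same]
    lia
  · have := card_replaceFiber_le_shade (S := S) (i := i) hj a
    rw [single_eq_of_ne (Ne.symm hjℓ)]
    lia

theorem sum_eq_sum_replaceFiber (hi : i ∈ s) (hS : S ⊆ monomials (insert ℓ s) e) :
    ∑ a ∈ S, a ℓ =
      ∑ ρ ∈ monomials s e, ∑ x ∈ (replaceFiber ℓ i S ρ).image (fun a => a ℓ), x := by
  rw [← Finset.sum_fiberwise_of_maps_to (g := replaceVar ℓ i)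
    fun _ ha => replaceVar_mem_monomials hi (hS ha)]
  exact Finset.sum_congr rfl fun ρ _ => (Finset.sum_image (f := fun x => x) (injOn_replaceFiber S ρ)).symm

/-- Compression lowers the total degree in `ℓ` strictly, unless the set is closed under replacing
a factor `ℓ` by `i`. -/
theorem sum_compress_lt (hi : i ∈ s) (hℓ : ℓ ∉ s) (hS : S ⊆ monomials (insert ℓ s) e)
    {a : σ →₀ ℕ} (ha : a + single ℓ 1 ∈ S) (hai : a + single i 1 ∉ S) :
    ∑ a ∈ compress s e ℓ i S, a ℓ < ∑ a ∈ S, a ℓ := by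
  have hiℓ : i ≠ ℓ := fun h => hℓ (h ▸ hi)
  have hcard : ∀ ρ, ((replaceFiber ℓ i S ρ).image fun a => a ℓ).card =
      (replaceFiber ℓ i S ρ).card := fun ρ => Finset.card_image_of_injOn (injOn_replaceFiber S ρ)
  rw [sum_eq_sum_replaceFiber hi hS, sum_eq_sum_replaceFiber hi compress_subset]
  simp only [image_replaceFiber_compress hi hℓ hS, ← hcard]
  refine Finset.sum_lt_sum (fun ρ _ => sum_range_card_le _)
    ⟨_, replaceVar_mem_monomials hi (hS ha), sum_range_card_lt fun h => hai ?_⟩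
  have h1 : a ℓ + 1 ∈ (replaceFiber ℓ i S (replaceVar ℓ i (a + single ℓ 1))).image fun a => a ℓ :=
    Finset.mem_image.2 ⟨_, mem_replaceFiber.2 ⟨ha, rfl⟩, by simp⟩
  -- If the exponents formed an initial segment, `a ℓ` would occur next to `a ℓ + 1`, and the fibre
  -- element with that exponent is `a + single i 1`.
  have h2 : a ℓ ∈ (replaceFiber ℓ i S (replaceVar ℓ i (a + single ℓ 1))).image fun a => a ℓ := by
    rw [h, Finset.mem_range] at h1 ⊢
    lia
  obtain ⟨x, hx, hxa⟩ := Finset.mem_image.1 h2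
  obtain ⟨hx, hxr⟩ := mem_replaceFiber.1 hx
  rwa [← eq_of_replaceVar_eq (ℓ := ℓ) (i := i) (a := x) (b := a + single i 1)]
  · rw [hxr, map_add, map_add, replaceVar_single_self, replaceVar_single_of_ne hiℓ]
  · simp [hxa, single_eq_of_ne hiℓ.symm]

/-- A candidate of least total degree in `ℓ` is closed, since compression would otherwise lower that
degree. -/
theorem exists_closed_card_shade_le (hℓ : ℓ ∉ s) (hS : S ⊆ monomials (insert ℓ s) e) :
    ∃ T ⊆ monomials (insert ℓ s) e, T.card = S.card ∧
      (shade (insert ℓ s) T).card ≤ (shade (insert ℓ s) S).card ∧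
      ∀ a, ∀ i ∈ s, a + single ℓ 1 ∈ T → a + single i 1 ∈ T := by
  obtain ⟨T, hT, hmin⟩ := Finset.exists_min_image
    ((monomials (insert ℓ s) e).powerset.filter fun T => T.card = S.card ∧
      (shade (insert ℓ s) T).card ≤ (shade (insert ℓ s) S).card) (fun T => ∑ a ∈ T, a ℓ)
    ⟨S, Finset.mem_filter.2 ⟨Finset.mem_powerset.2 hS, rfl, le_rfl⟩⟩
  obtain ⟨hTS, hcard, hshade⟩ := Finset.mem_filter.1 hT
  rw [Finset.mem_powerset] at hTS
  refine ⟨T, hTS, hcard, hshade, fun a i hi ha => ?_⟩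
  by_contra hai
  refine absurd (hmin (compress s e ℓ i T) (Finset.mem_filter.2
    ⟨Finset.mem_powerset.2 compress_subset, ?_, ?_⟩)) (not_le.2 (sum_compress_lt hi hℓ hTS ha hai))
  · rw [card_compress hi hℓ hTS, hcard]
  · exact (card_shade_compress_le hi hℓ hTS).trans hshade

end Compression

/-! ### Macaulay's theorem on shades -/

section MacaulayTheorem

variable {σ : Type*} [LinearOrder σ] {s : Finset σ} {e : ℕ} {ℓ : σ}

theorem toLex_replaceVar_le {m : σ} (hm : ∀ i ∈ s, i ≤ m) (hms : m ∈ s) (hmℓ : m < ℓ)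
    {a b : σ →₀ ℕ} (ha : a ∈ monomials (insert ℓ s) e) (hb : b ∈ monomials (insert ℓ s) e)
    (hab : toLex a ≤ toLex b) : toLex (replaceVar ℓ m a) ≤ toLex (replaceVar ℓ m b) := by
  have happ : ∀ (x : σ →₀ ℕ) (q : σ), q < m → replaceVar ℓ m x q = x q := by
    intro x q hq
    obtain ⟨y, hy0, hy⟩ := exists_eq_add_single ℓ x
    rw [hy, replaceVar_add_single hy0, Finsupp.add_apply, Finsupp.add_apply,
      single_eq_of_ne hq.ne, single_eq_of_ne (hq.trans hmℓ).ne]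
  have ha' := replaceVar_mem_monomials hms ha
  have hb' := replaceVar_mem_monomials hms hb
  by_contra hlt
  obtain ⟨p, hpm, hpq, hp⟩ := exists_lt_of_toLex_lt (m := m)
    ((mem_monomials.1 hb').1.trans (mem_monomials.1 ha').1.symm)
    (fun j hj => hm j ((mem_monomials.1 hb').2 hj)) (not_le.1 hlt)
  refine absurd hab (not_le.2 (Finsupp.Lex.lt_iff.2 ⟨p, fun q hq => ?_, ?_⟩))
  · have := hpq q hq
    rwa [happ _ _ (hq.trans hpm), happ _ _ (hq.trans hpm)] at this
  · rwa [happ _ _ hpm, happ _ _ hpm] at hp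

/-- As `ℓ` is the last variable, an element of the shade divisible by `ℓ` is `ℓ` times an element of
`L`. The bound is matched from below for arbitrary sets by `card_add_card_shade_le`. -/
theorem IsLexSegment.card_shade_insert_le (hℓ : ∀ i ∈ s, i < ℓ) {L : Finset (σ →₀ ℕ)}
    (hL : IsLexSegment (insert ℓ s) e L) :
    (CircuitSets.shade (insert ℓ s) L).card ≤
      L.card + (CircuitSets.shade s (L.filter fun a => a ℓ = 0)).card := by
  rw [← Finset.card_image_of_injective L (add_left_injective (single ℓ 1))]
  refine le_trans (Finset.card_le_card fun b hb => ?_) (Finset.card_union_le _ _)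
  have hbm := shade_subset_monomials hL.subset hb
  obtain ⟨a, ha, i, hi, rfl⟩ := mem_shade.1 hb
  rw [Finset.mem_union]
  by_cases h0 : (a + single i 1 : σ →₀ ℕ) ℓ = 0
  · right
    have hiℓ : i ≠ ℓ := by
      rintro rfl
      simp at h0
    refine add_single_mem_shade (Finset.mem_filter.2 ⟨ha, ?_⟩)
      (Finset.mem_of_mem_insert_of_ne hi hiℓ)
    rw [Finsupp.add_apply] at h0
    lia
  · left
    obtain ⟨c, hc⟩ : ∃ c, a + single i 1 = c + single ℓ 1 :=
      ⟨a + single i 1 - single ℓ 1, (tsub_add_cancel_of_le (single_le_iff.2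
        (Nat.one_le_iff_ne_zero.2 h0))).symm⟩
    refine Finset.mem_image.2 ⟨c, hL.mem_of_add_single ha hi (hc ▸ hbm) (fun q hq => ?_)
      (hc ▸ le_rfl), hc.symm⟩
    rcases Finset.mem_insert.1 ((mem_monomials.1 hbm).2 (hc ▸ hq)) with h | h
    · exact h.le
    · exact (hℓ q h).le

theorem card_add_card_shade_le {T U : Finset (σ →₀ ℕ)} (hℓ : ℓ ∉ s) (hUs : U ⊆ monomials s e)
    (hUT : U ⊆ T) : T.card + (shade s U).card ≤ (shade (insert ℓ s) T).card := by
  rw [← Finset.card_image_of_injective T (add_left_injective (single ℓ 1)),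
    ← Finset.card_union_of_disjoint]
  · refine Finset.card_le_card (Finset.union_subset (fun b hb => ?_)
      (shade_mono (Finset.subset_insert _ _) hUT))
    obtain ⟨a, ha, rfl⟩ := Finset.mem_image.1 hb
    exact add_single_mem_shade ha (Finset.mem_insert_self _ _)
  · rw [Finset.disjoint_left]
    intro b hb hbU
    obtain ⟨a, ha, rfl⟩ := Finset.mem_image.1 hb
    have := eq_zero_of_mem_monomials (shade_subset_monomials hUs hbU) hℓ
    simp at this

/-- Macaulay's theorem, in the combinatorial form: among the sets of monomials of a given degree
with a given cardinality, the lex-segments have the smallest shade. -/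
theorem IsLexSegment.card_shade_le {s : Finset σ} {e : ℕ} {L S : Finset (σ →₀ ℕ)}
    (hL : IsLexSegment s e L) (hS : S ⊆ monomials s e) (hLS : L.card ≤ S.card) :
    (CircuitSets.shade s L).card ≤ (CircuitSets.shade s S).card := by
  induction s using Finset.induction_on_max generalizing e L S with
  | empty => simp [CircuitSets.shade]
  | insert ℓ s hlt ih =>
    have hℓs : ℓ ∉ s := fun h => lt_irrefl _ (hlt ℓ h)
    rcases s.eq_empty_or_nonempty with rfl | hne
    · refine Finset.card_le_card (shade_mono subset_rfl fun a ha => ?_)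
      obtain ⟨b, hb⟩ := Finset.card_pos.1 ((Finset.card_pos.2 ⟨a, ha⟩).trans_le hLS)
      have hsingle : ∀ x ∈ monomials (insert ℓ ∅) e, x = single ℓ e := by
        intro x hx
        obtain ⟨y, hy⟩ := support_subset_singleton'.1 (mem_monomials.1 hx).2
        rw [hy, ← (mem_monomials.1 hx).1, hy, degree_single]
      rwa [hsingle a (hL.subset ha), ← hsingle b (hS hb)]
    obtain ⟨m, hms, hm⟩ := Finset.exists_max_image s id hne
    have hmℓ := hlt m hms
    obtain ⟨T, hT, hTcard, hTshade, hTclosed⟩ := exists_closed_card_shade_le hℓs hS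
    refine le_trans ?_ hTshade
    -- Slice `T` by the exponent `c` of `ℓ`, and let `C c` be the lex-segment in the variables `s`
    -- as large as the slice. Closedness of `T` nests the slices under shades, and induction
    -- transfers this to the `C c`.
    set sl : ℕ → Finset (σ →₀ ℕ) := fun c =>
      (monomials s (e - c)).filter fun b => b + single ℓ c ∈ T with hsl
    have hsl_sub : ∀ c, sl c ⊆ monomials s (e - c) := fun c => Finset.filter_subset _ _
    choose C hC hCcard using fun c => exists_isLexSegment s (e - c) (Finset.card_le_card (hsl_sub c))
    have hsl_shade : ∀ c, c + 1 ≤ e → CircuitSets.shade s (sl (c + 1)) ⊆ sl c := by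
      intro c hc b hb
      have hbm := shade_subset_monomials (hsl_sub (c + 1)) hb
      obtain ⟨a, ha, i, hi, rfl⟩ := mem_shade.1 hb
      refine Finset.mem_filter.2 ⟨?_, ?_⟩
      · rwa [show e - (c + 1) + 1 = e - c by lia] at hbm
      · rw [add_right_comm]
        refine hTclosed _ i hi ?_
        rw [add_assoc, ← single_add]
        exact (Finset.mem_filter.1 ha).2
    have hC_shade : ∀ c, c + 1 ≤ e → CircuitSets.shade s (C (c + 1)) ⊆ C c := by
      intro c hc
      have h1 := (hC (c + 1)).shade
      rw [show e - (c + 1) + 1 = e - c by lia] at h1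
      refine h1.subset_of_card_le (hC c) ?_
      rw [hCcard c]
      exact (ih (hC (c + 1)) (hsl_sub (c + 1)) (hCcard (c + 1)).le).trans
        (Finset.card_le_card (hsl_shade c hc))
    have hC_zero : ∀ c, c ≤ e → ∀ b ∈ C c, b + single m c ∈ C 0 := by
      intro c
      induction c with
      | zero => simp
      | succ c ihc =>
        intro hc b hb
        have := ihc (by lia) _ (hC_shade c hc (add_single_mem_shade hb hms))
        rwa [add_assoc, ← single_add, add_comm 1 c] at this
    -- `Q` is a lex-segment containing `C c` times the `c`-th power of `ℓ` for every `c ≤ e`, so it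
    -- is at least as large as `T` and contains `L`. Hence the `ℓ`-free part of `L` lies in `C 0`.
    set Q := (monomials (insert ℓ s) e).filter fun a => replaceVar ℓ m a ∈ C 0 with hQ
    have hQlex : IsLexSegment (insert ℓ s) e Q := by
      refine ⟨Finset.filter_subset _ _, fun a ha b hb hab => ?_⟩
      obtain ⟨ham, haC⟩ := Finset.mem_filter.1 ha
      exact Finset.mem_filter.2 ⟨hb, (hC 0).mem_of_le _ haC _ (replaceVar_mem_monomials hms hb)
        (toLex_replaceVar_le hm hms hmℓ ham hb hab)⟩
    have hmaps : ∀ R ⊆ monomials (insert ℓ s) e,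
        R.card = ∑ c ∈ Finset.range (e + 1), (R.filter fun a => a ℓ = c).card := by
      intro R hR
      refine Finset.card_eq_sum_card_fiberwise fun a ha => ?_
      rw [Finset.coe_range, Set.mem_Iio, Nat.lt_succ_iff, ← (mem_monomials.1 (hR ha)).1]
      exact le_degree ℓ a
    have hTQ : T.card ≤ Q.card := by
      rw [hmaps T hT, hmaps Q hQlex.subset]
      refine Finset.sum_le_sum fun c hc => ?_
      have hce : c ≤ e := Nat.lt_succ_iff.1 (Finset.mem_range.1 hc)
      calc (T.filter fun a => a ℓ = c).card ≤ ((sl c).image (· + single ℓ c)).card := by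
            refine Finset.card_le_card fun a ha => ?_
            obtain ⟨haT, rfl⟩ := Finset.mem_filter.1 ha
            obtain ⟨b, hb0, hb⟩ := exists_eq_add_single ℓ a
            refine Finset.mem_image.2 ⟨b, Finset.mem_filter.2 ⟨?_, hb ▸ haT⟩, hb.symm⟩
            refine mem_monomials_of_insert (mem_monomials_of_add_single (i := ℓ) (c := a ℓ) ?_) hb0
            rw [Nat.sub_add_cancel hce, ← hb]
            exact hT haT
        _ ≤ (C c).card := Finset.card_image_le.trans (hCcard c).ge
        _ = ((C c).image (· + single ℓ c)).card :=
            (Finset.card_image_of_injective _ (add_left_injective _)).symm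
        _ ≤ (Q.filter fun a => a ℓ = c).card := by
            refine Finset.card_le_card fun a ha => ?_
            obtain ⟨b, hb, rfl⟩ := Finset.mem_image.1 ha
            have hbm := (hC c).subset hb
            have hb0 := eq_zero_of_mem_monomials hbm hℓs
            refine Finset.mem_filter.2 ⟨Finset.mem_filter.2 ⟨?_, ?_⟩, by simp [hb0]⟩
            · have := add_single_mem_monomials (c := c)
                (monomials_mono (Finset.subset_insert ℓ s) _ hbm) (Finset.mem_insert_self _ _)
              rwa [Nat.sub_add_cancel hce] at this
            · rw [replaceVar_add_single hb0]
              exact hC_zero c hce b hb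
    have hLQ : L ⊆ Q := hL.subset_of_card_le hQlex (hLS.trans (hTcard ▸ hTQ))
    have hL0 : (L.filter fun a => a ℓ = 0) ⊆ C 0 := by
      intro a ha
      obtain ⟨haL, ha0⟩ := Finset.mem_filter.1 ha
      have := (Finset.mem_filter.1 (hLQ haL)).2
      rwa [replaceVar_of_eq_zero ha0] at this
    have hsl0 : sl 0 ⊆ T := fun a ha => by simpa using (Finset.mem_filter.1 ha).2
    calc (CircuitSets.shade (insert ℓ s) L).card
        ≤ L.card + (CircuitSets.shade s (L.filter fun a => a ℓ = 0)).card :=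
          hL.card_shade_insert_le hlt
      _ ≤ T.card + (CircuitSets.shade s (sl 0)).card :=
          add_le_add (hLS.trans hTcard.ge) ((Finset.card_le_card (shade_mono subset_rfl hL0)).trans
            (ih (hC 0) (hsl_sub 0) (hCcard 0).le))
      _ ≤ (CircuitSets.shade (insert ℓ s) T).card := card_add_card_shade_le hℓs (hsl_sub 0) hsl0

end MacaulayTheorem

end CircuitSets

namespace CircuitSets

open MvPolynomial

/-! ### Generation of ideals in degrees at most `d` -/

section LexSegments

variable {K : Type*} [Field K] {n : ℕ} {I M N : Ideal (MvPolynomial (Fin n) K)} {e d : ℕ}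

theorem mem_homogeneousPart {f : MvPolynomial (Fin n) K} :
    f ∈ homogeneousPart I e ↔ f ∈ I ∧ f.IsHomogeneous e := by
  rw [homogeneousPart, Submodule.mem_inf, Submodule.restrictScalars_mem, mem_homogeneousSubmodule]

theorem degree_eq_of_mem_support {f : MvPolynomial (Fin n) K} (hf : f.IsHomogeneous e)
    {a : Fin n →₀ ℕ} (ha : a ∈ f.support) : a.degree = e := by
  by_contra h
  exact mem_support_iff.1 ha (hf.coeff_eq_zero h)

theorem isHomogeneous_of_forall_degree {f : MvPolynomial (Fin n) K}
    (h : ∀ a ∈ f.support, a.degree = e) : f.IsHomogeneous e := by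
  intro a ha
  exact (DFunLike.congr_fun Finsupp.degree_eq_weight_one a).symm.trans (h a (mem_support_iff.2 ha))

theorem mem_monomials_univ {a : Fin n →₀ ℕ} : a ∈ monomials Finset.univ e ↔ a.degree = e := by
  rw [mem_monomials, and_iff_left (Finset.subset_univ _)]

theorem hasFiniteSupport_homogeneousPart (I : Ideal (MvPolynomial (Fin n) K)) (e : ℕ) :
    HasFiniteSupport (homogeneousPart I e) :=
  ⟨monomials Finset.univ e, fun _ hf _ ha =>
    mem_monomials_univ.2 (degree_eq_of_mem_support (mem_homogeneousPart.1 hf).2 ha)⟩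

/-- The lexicographic leading monomials of the elements of degree `e` of `I`. -/
noncomputable def lexLeading (I : Ideal (MvPolynomial (Fin n) K)) (e : ℕ) :
    Finset (Fin n →₀ ℕ) :=
  ((hasFiniteSupport_homogeneousPart I e).finite_leadingMonomials toLex).toFinset

theorem coe_lexLeading (I : Ideal (MvPolynomial (Fin n) K)) (e : ℕ) :
    (lexLeading I e : Set (Fin n →₀ ℕ)) = leadingMonomials toLex (homogeneousPart I e) :=
  Set.Finite.coe_toFinset _

theorem mem_lexLeading {a : Fin n →₀ ℕ} :
    a ∈ lexLeading I e ↔ a ∈ leadingMonomials toLex (homogeneousPart I e) :=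
  Set.Finite.mem_toFinset _

theorem lexLeading_subset (I : Ideal (MvPolynomial (Fin n) K)) (e : ℕ) :
    lexLeading I e ⊆ monomials Finset.univ e := by
  intro a ha
  obtain ⟨f, hf, haf, -⟩ := mem_lexLeading.1 ha
  exact mem_monomials_univ.2 (degree_eq_of_mem_support (mem_homogeneousPart.1 hf).2 haf)

theorem card_lexLeading (I : Ideal (MvPolynomial (Fin n) K)) (e : ℕ) :
    (lexLeading I e).card = hilbertFunction I e := by
  obtain ⟨F, hF, -⟩ := exists_isReducedBasis toLex.injective (coe_lexLeading I e).symm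
  exact hF.finrank_eq.symm

theorem shade_lexLeading_subset {V : Submodule K (MvPolynomial (Fin n) K)}
    (hV : ∀ f ∈ homogeneousPart M e, ∀ i, f * X i ∈ V) :
    (shade Finset.univ (lexLeading M e) : Set (Fin n →₀ ℕ)) ⊆ leadingMonomials toLex V := by
  intro b hb
  obtain ⟨a, ha, i, -, rfl⟩ := mem_shade.1 hb
  obtain ⟨f, hf, haf, hle⟩ := mem_lexLeading.1 ha
  refine ⟨f * X i, hV f hf i, ?_, fun c hc => ?_⟩
  · rwa [mem_support_iff, coeff_mul_X, ← mem_support_iff]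
  · rw [support_mul_X, Finset.mem_map] at hc
    obtain ⟨x, hx, rfl⟩ := hc
    rw [addRightEmbedding_apply, toLex_add, toLex_add]
    exact add_le_add_left (hle x hx) _

theorem mul_X_mem_homogeneousPart {f : MvPolynomial (Fin n) K} (hf : f ∈ homogeneousPart M e)
    (i : Fin n) : f * X i ∈ homogeneousPart M (e + 1) := by
  rw [mem_homogeneousPart] at hf ⊢
  exact ⟨M.mul_mem_right _ hf.1, hf.2.mul (isHomogeneous_X _ i)⟩

theorem shade_lexLeading_subset_succ (M : Ideal (MvPolynomial (Fin n) K)) (e : ℕ) :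
    shade Finset.univ (lexLeading M e) ⊆ lexLeading M (e + 1) := by
  rw [← Finset.coe_subset, coe_lexLeading]
  exact shade_lexLeading_subset fun f hf i => mul_X_mem_homogeneousPart hf i

/-- The lex-segment with as many elements as the degree `e` part of `I` has dimensions. -/
theorem exists_lexSegment_card_eq_hilbertFunction (I : Ideal (MvPolynomial (Fin n) K)) (e : ℕ) :
    ∃ L, IsLexSegment (Finset.univ : Finset (Fin n)) e L ∧ L.card = hilbertFunction I e :=
  exists_isLexSegment _ _
    (card_lexLeading I e ▸ Finset.card_le_card (lexLeading_subset I e))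

theorem IsLexSegment.mem_iff_ncard_lt {L : Finset (Fin n →₀ ℕ)}
    (hL : IsLexSegment Finset.univ e L) {a : Fin n →₀ ℕ} (ha : a.degree = e) :
    a ∈ L ↔ {b : Fin n →₀ ℕ | b.degree = a.degree ∧ toLex a < toLex b}.ncard < L.card := by
  have hset : {b : Fin n →₀ ℕ | b.degree = a.degree ∧ toLex a < toLex b} =
      ((monomials Finset.univ e).filter fun b => toLex a < toLex b : Finset (Fin n →₀ ℕ)) := by
    ext b
    simp [mem_monomials_univ, ha]
  rw [hset, Set.ncard_coe_finset]
  constructor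
  · intro haL
    refine Finset.card_lt_card ((Finset.ssubset_iff_of_subset fun b hb => ?_).2
      ⟨a, haL, fun h => lt_irrefl _ (Finset.mem_filter.1 h).2⟩)
    obtain ⟨hb, hab⟩ := Finset.mem_filter.1 hb
    exact hL.mem_of_le a haL b hb hab.le
  · intro hlt
    by_contra haL
    refine absurd (Finset.card_le_card fun b hb => ?_) (not_le.2 hlt)
    refine Finset.mem_filter.2 ⟨hL.subset hb, not_le.1 fun hba => haL ?_⟩
    exact hL.mem_of_le b hb a (mem_monomials_univ.2 ha) hba

variable {L : ℕ → Finset (Fin n →₀ ℕ)}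

/-- By Macaulay's theorem the shade of `L e` is no larger than that of the leading monomials of
`I_e`, which lies in the leading monomials of `I_{e+1}`. -/
theorem shade_lexSegment_subset (hL : ∀ e, IsLexSegment Finset.univ e (L e))
    (hcard : ∀ e, (L e).card = hilbertFunction I e) (e : ℕ) :
    shade Finset.univ (L e) ⊆ L (e + 1) := by
  refine (hL e).shade.subset_of_card_le (hL (e + 1)) ?_
  rw [hcard, ← card_lexLeading]
  refine ((hL e).card_shade_le (lexLeading_subset I e) ?_).trans
    (Finset.card_le_card (shade_lexLeading_subset_succ I e))
  rw [hcard, card_lexLeading]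

theorem add_mem_lexSegment (hL : ∀ e, IsLexSegment Finset.univ e (L e))
    (hcard : ∀ e, (L e).card = hilbertFunction I e) {a : Fin n →₀ ℕ} (ha : a ∈ L a.degree)
    (c : Fin n →₀ ℕ) : a + c ∈ L (a + c).degree := by
  induction c using Finsupp.induction_linear generalizing a with
  | zero => rwa [add_zero]
  | add f g hf hg =>
    rw [← add_assoc]
    exact hg (hf ha)
  | single i m =>
    induction m with
    | zero => rwa [Finsupp.single_zero, add_zero]
    | succ m ih =>
      have := shade_lexSegment_subset hL hcard _
        (add_single_mem_shade ih (Finset.mem_univ i))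
      rw [add_assoc, ← Finsupp.single_add] at this
      rwa [Finsupp.single_add, ← add_assoc, map_add _ _ (Finsupp.single i 1),
        Finsupp.degree_single, add_assoc, ← Finsupp.single_add]

/-- The segments are closed under multiplication by monomials, so the ideal they generate contains
no further monomials. -/
theorem monomial_mem_lexSegmentIdeal (hL : ∀ e, IsLexSegment Finset.univ e (L e))
    (hcard : ∀ e, (L e).card = hilbertFunction I e) {a : Fin n →₀ ℕ} :
    monomial a (1 : K) ∈ lexSegmentIdeal I ↔ a ∈ L a.degree := by
  classical
  have hspan : lexSegmentIdeal I =
      Ideal.span ((fun a => monomial a (1 : K)) '' {a | a ∈ L a.degree}) := by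
    rw [lexSegmentIdeal]
    congr 1
    ext m
    simp only [Set.mem_ofPred_eq, Set.mem_image, ← hcard]
    refine exists_congr fun b => ?_
    rw [(hL _).mem_iff_ncard_lt rfl, and_comm, eq_comm]
  rw [hspan, mem_ideal_span_monomial_image, support_monomial, if_neg one_ne_zero]
  simp only [Finset.mem_singleton, forall_eq, Set.mem_ofPred_eq]
  constructor
  · rintro ⟨b, hb, hba⟩
    obtain ⟨c, rfl⟩ := exists_add_of_le hba
    exact add_mem_lexSegment hL hcard hb c
  · exact fun h => ⟨a, h, le_rfl⟩

theorem lexSegment_succ_subset_shade (hL : ∀ e, IsLexSegment Finset.univ e (L e))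
    (hcard : ∀ e, (L e).card = hilbertFunction I e)
    (hd : ∀ a ∈ minimalGenerators (lexSegmentIdeal I), a.degree ≤ d) (hde : d ≤ e) :
    L (e + 1) ⊆ shade Finset.univ (L e) := by
  intro a ha
  have hdeg := mem_monomials_univ.1 ((hL (e + 1)).subset ha)
  have hmem : monomial a (1 : K) ∈ lexSegmentIdeal I :=
    (monomial_mem_lexSegmentIdeal hL hcard).2 (hdeg.symm ▸ ha)
  have hnot : ¬ Minimal (fun b => monomial b (1 : K) ∈ lexSegmentIdeal I) a := fun h => by
    have := hd a h
    lia
  rw [minimal_iff_forall_lt] at hnot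
  push Not at hnot
  obtain ⟨b, hba, hb⟩ := hnot hmem
  rw [monomial_mem_lexSegmentIdeal hL hcard] at hb
  obtain ⟨c, rfl⟩ := exists_add_of_le hba.le
  have hc : c.support.Nonempty := by
    rw [Finsupp.support_nonempty_iff]
    rintro rfl
    simp at hba
  obtain ⟨i, hi⟩ := hc
  obtain ⟨x, rfl⟩ := exists_add_of_le (Finsupp.single_le_iff.2
    (Nat.one_le_iff_ne_zero.2 (Finsupp.mem_support_iff.1 hi)))
  have hx := add_mem_lexSegment hL hcard hb x
  rw [add_left_comm, add_comm] at hdeg ⊢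
  rw [map_add, Finsupp.degree_single, Nat.add_right_cancel_iff] at hdeg
  exact add_single_mem_shade (hdeg ▸ hx) (Finset.mem_univ i)

/-- Beyond the degrees of the minimal generators of the lex-segment ideal, the leading monomials of
any ideal with the same Hilbert function are multiples of those of lower degree. -/
theorem lexLeading_succ_subset_shade (hIM : ∀ e, hilbertFunction M e = hilbertFunction I e)
    (hd : ∀ a ∈ minimalGenerators (lexSegmentIdeal I), a.degree ≤ d) (hde : d ≤ e) :
    lexLeading M (e + 1) ⊆ shade Finset.univ (lexLeading M e) := by
  choose L hL hcard using exists_lexSegment_card_eq_hilbertFunction I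
  refine (Finset.eq_of_subset_of_card_le (shade_lexLeading_subset_succ M e) ?_).ge
  rw [card_lexLeading, hIM, ← hcard]
  refine (Finset.card_le_card (lexSegment_succ_subset_shade hL hcard hd hde)).trans
    ((hL e).card_shade_le (lexLeading_subset M e) ?_)
  rw [hcard, card_lexLeading, hIM]

theorem le_of_leadingMonomials_subset {V W : Submodule K (MvPolynomial (Fin n) K)}
    {k : (Fin n →₀ ℕ) → Lex (Fin n →₀ ℕ)} (hk : Function.Injective k) (hV : HasFiniteSupport V)
    (hWV : W ≤ V) (h : leadingMonomials k V ⊆ leadingMonomials k W) : V ≤ W := by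
  have hfin := hV.finite_leadingMonomials k
  have hB := hfin.coe_toFinset.symm
  have hBW : leadingMonomials k W = hfin.toFinset := by
    rw [← hB]
    exact Set.Subset.antisymm (fun b ⟨f, hf, hb⟩ => ⟨f, hWV hf, hb⟩) h
  obtain ⟨F, hF, -⟩ := exists_isReducedBasis hk hB
  obtain ⟨G, hG, -⟩ := exists_isReducedBasis hk hBW
  intro f hf
  rw [hF.eq_of_coeff hf (hWV (hG.sum_mem fun b => coeff b f)) fun b hb =>
    (hG.coeff_sum (fun b => coeff b f) hb).symm]
  exact hG.sum_mem _

/-- The intersection of `M_{e+1}` and `N_{e+1}` contains all multiples of `M_e` by variables, whose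
leading monomials already exhaust those of `M_{e+1}`. -/
theorem homogeneousPart_succ_le (hIM : ∀ e, hilbertFunction M e = hilbertFunction I e)
    (hd : ∀ a ∈ minimalGenerators (lexSegmentIdeal I), a.degree ≤ d) (hde : d ≤ e)
    (h : homogeneousPart M e ≤ homogeneousPart N e) :
    homogeneousPart M (e + 1) ≤ homogeneousPart N (e + 1) := by
  refine le_trans (le_of_leadingMonomials_subset toLex.injective
    (hasFiniteSupport_homogeneousPart M (e + 1))
    (inf_le_left (b := homogeneousPart N (e + 1))) ?_) inf_le_right
  rw [← coe_lexLeading]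
  exact (Finset.coe_subset.2 (lexLeading_succ_subset_shade hIM hd hde)).trans
    (shade_lexLeading_subset fun f hf i =>
      ⟨mul_X_mem_homogeneousPart hf i, mul_X_mem_homogeneousPart (h hf) i⟩)

theorem homogeneousPart_le_of_forall_le (hIM : ∀ e, hilbertFunction M e = hilbertFunction I e)
    (hd : ∀ a ∈ minimalGenerators (lexSegmentIdeal I), a.degree ≤ d)
    (h : ∀ e ≤ d, homogeneousPart M e ≤ homogeneousPart N e) (e : ℕ) :
    homogeneousPart M e ≤ homogeneousPart N e := by
  rcases le_total e d with hed | hde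
  · exact h e hed
  · induction e, hde using Nat.le_induction with
    | base => exact h d le_rfl
    | succ e hde ih => exact homogeneousPart_succ_le hIM hd hde ih

theorem le_of_homogeneousPart_le (hM : M.IsHomogeneous (homogeneousSubmodule (Fin n) K))
    (h : ∀ e, homogeneousPart M e ≤ homogeneousPart N e) : M ≤ N := by
  intro f hf
  rw [← sum_homogeneousComponent f]
  exact N.sum_mem fun e _ => (mem_homogeneousPart.1 (h e (mem_homogeneousPart.2
    ⟨(mem_iff_homogeneousComponent_mem hM f).1 hf e, homogeneousComponent_isHomogeneous e f⟩))).1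

end LexSegments

/-! ### Initial ideals of homogeneous ideals -/

section InitialIdeals

variable {K : Type*} [Field K] {n : ℕ} {I J L : Ideal (MvPolynomial (Fin n) K)} {d : ℕ}
  {ω ω' : Fin n → ℝ}

theorem monomialWeight_add (ω : Fin n → ℝ) (a b : Fin n →₀ ℕ) :
    monomialWeight ω (a + b) = monomialWeight ω a + monomialWeight ω b := by
  simp [monomialWeight, mul_add, Finset.sum_add_distrib]

theorem initialForm_monomial_mul (u : Fin n →₀ ℕ) {r : K} (hr : r ≠ 0)
    (f : MvPolynomial (Fin n) K) :
    initialForm ω (monomial u r * f) = monomial u r * initialForm ω f := by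
  by_cases hf : f = 0
  · rw [hf, mul_zero, initialForm_zero, mul_zero]
  obtain ⟨b, hb, hmax⟩ := exists_maximal_weight ω hf
  have hub : u + b ∈ (monomial u r * f).support := by
    rw [mem_support_iff, coeff_monomial_mul]
    exact mul_ne_zero hr (mem_support_iff.1 hb)
  have hmax' : ∀ c ∈ (monomial u r * f).support,
      monomialWeight ω c ≤ monomialWeight ω (u + b) := by
    intro c hc
    rw [mem_support_iff, coeff_monomial_mul'] at hc
    obtain ⟨huc, hne⟩ := ite_ne_right_iff.1 hc
    obtain ⟨x, rfl⟩ := exists_add_of_le huc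
    rw [add_tsub_cancel_left] at hne
    rw [monomialWeight_add, monomialWeight_add]
    exact add_le_add_right (hmax x (mem_support_iff.2 (right_ne_zero_of_mul hne))) _
  ext a
  rw [coeff_initialForm_of_maximal hub hmax', coeff_monomial_mul', coeff_monomial_mul']
  by_cases hua : u ≤ a
  · obtain ⟨x, rfl⟩ := exists_add_of_le hua
    rw [if_pos hua, if_pos hua, add_tsub_cancel_left, coeff_initialForm_of_maximal hb hmax,
      monomialWeight_add, monomialWeight_add, mul_ite, mul_zero]
    exact if_congr (add_right_inj _) rfl rfl
  · rw [if_neg hua, if_neg hua, ite_self]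

/-- Initial forms commute with multiplication by a nonzero term, so the `K`-span of the initial
forms is already an ideal. -/
theorem mem_initialIdeal {g : MvPolynomial (Fin n) K} :
    g ∈ initialIdeal ω I ↔ g ∈ initialSpan ω (I.restrictScalars K) := by
  constructor
  · intro hg
    have hmul : ∀ p, ∀ g ∈ initialSpan ω (I.restrictScalars K),
        p * g ∈ initialSpan ω (I.restrictScalars K) := by
      intro p g hg
      induction p using MvPolynomial.induction_on' with
      | monomial u r =>
        by_cases hr : r = 0
        · simp [hr]
        induction hg using Submodule.span_induction with
        | mem g hg =>
          obtain ⟨f, hf, rfl⟩ := hg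
          rw [← initialForm_monomial_mul u hr]
          exact initialForm_mem_initialSpan (I.mul_mem_left _ hf)
        | zero => simp
        | add x y _ _ hx hy =>
          rw [mul_add]
          exact Submodule.add_mem _ hx hy
        | smul c x _ hx =>
          rw [mul_smul_comm]
          exact Submodule.smul_mem _ _ hx
      | add p q hp hq =>
        rw [add_mul]
        exact Submodule.add_mem _ hp hq
    induction hg using Submodule.span_induction with
    | mem g hg =>
      obtain ⟨f, hf, rfl⟩ := hg
      exact initialForm_mem_initialSpan hf
    | zero => exact Submodule.zero_mem _
    | add x y _ _ hx hy => exact Submodule.add_mem _ hx hy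
    | smul p x _ hx => exact hmul p x hx
  · intro hg
    have hle : initialSpan ω (I.restrictScalars K) ≤ (initialIdeal ω I).restrictScalars K :=
      Submodule.span_le.2 Ideal.subset_span
    exact hle hg

/-- When the component is nonzero, the degree `e` part of `f` attains the top weight of `f`, and the
component is the initial form of that part. -/
theorem homogeneousComponent_initialForm_mem
    (hI : I.IsHomogeneous (homogeneousSubmodule (Fin n) K)) {f : MvPolynomial (Fin n) K}
    (hf : f ∈ I) (e : ℕ) :
    homogeneousComponent e (initialForm ω f) ∈ initialSpan ω (homogeneousPart I e) := by
  by_cases h0 : homogeneousComponent e (initialForm ω f) = 0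
  · rw [h0]
    exact Submodule.zero_mem _
  have hf0 : f ≠ 0 := by
    rintro rfl
    simp [initialForm_zero] at h0
  obtain ⟨b, hb, hmax⟩ := exists_maximal_weight ω hf0
  obtain ⟨a, ha⟩ := support_nonempty.2 h0
  rw [mem_support_iff, coeff_homogeneousComponent, coeff_initialForm_of_maximal hb hmax] at ha
  obtain ⟨hae, ha⟩ := ite_ne_right_iff.1 ha
  obtain ⟨hab, haf⟩ := ite_ne_right_iff.1 ha
  have hag : a ∈ (homogeneousComponent e f).support := by
    rwa [mem_support_iff, coeff_homogeneousComponent, if_pos hae]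
  have hmax' : ∀ c ∈ (homogeneousComponent e f).support,
      monomialWeight ω c ≤ monomialWeight ω a := by
    intro c hc
    rw [mem_support_iff, coeff_homogeneousComponent] at hc
    rw [hab]
    exact hmax c (mem_support_iff.2 (ite_ne_right_iff.1 hc).2)
  have heq : homogeneousComponent e (initialForm ω f) =
      initialForm ω (homogeneousComponent e f) := by
    ext c
    rw [coeff_homogeneousComponent, coeff_initialForm_of_maximal hb hmax,
      coeff_initialForm_of_maximal hag hmax', coeff_homogeneousComponent, hab]
    split_ifs <;> rfl
  rw [heq]
  exact initialForm_mem_initialSpan (mem_homogeneousPart.2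
    ⟨(mem_iff_homogeneousComponent_mem hI f).1 hf e, homogeneousComponent_isHomogeneous e f⟩)

theorem homogeneousComponent_mem_initialSpan
    (hI : I.IsHomogeneous (homogeneousSubmodule (Fin n) K)) {g : MvPolynomial (Fin n) K}
    (hg : g ∈ initialIdeal ω I) (e : ℕ) :
    homogeneousComponent e g ∈ initialSpan ω (homogeneousPart I e) := by
  rw [mem_initialIdeal] at hg
  induction hg using Submodule.span_induction with
  | mem g hg =>
    obtain ⟨f, hf, rfl⟩ := hg
    exact homogeneousComponent_initialForm_mem hI hf e
  | zero =>
    rw [map_zero]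
    exact Submodule.zero_mem _
  | add x y _ _ hx hy =>
    rw [map_add]
    exact Submodule.add_mem _ hx hy
  | smul c x _ hx =>
    rw [map_smul]
    exact Submodule.smul_mem _ _ hx

theorem initialSpan_homogeneousPart_le (I : Ideal (MvPolynomial (Fin n) K)) (e : ℕ) :
    initialSpan ω (homogeneousPart I e) ≤ homogeneousPart (initialIdeal ω I) e := by
  refine Submodule.span_le.2 ?_
  rintro _ ⟨f, hf, rfl⟩
  obtain ⟨hfI, hfe⟩ := mem_homogeneousPart.1 hf
  exact mem_homogeneousPart.2 ⟨Ideal.subset_span ⟨f, hfI, rfl⟩,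
    isHomogeneous_of_forall_degree fun a ha =>
      degree_eq_of_mem_support hfe (support_initialForm_subset f ha)⟩

theorem homogeneousPart_initialIdeal (hI : I.IsHomogeneous (homogeneousSubmodule (Fin n) K))
    (ω : Fin n → ℝ) (e : ℕ) :
    homogeneousPart (initialIdeal ω I) e = initialSpan ω (homogeneousPart I e) := by
  refine le_antisymm (fun g hg => ?_) (initialSpan_homogeneousPart_le I e)
  obtain ⟨hgI, hge⟩ := mem_homogeneousPart.1 hg
  have := homogeneousComponent_mem_initialSpan hI hgI e
  rwa [homogeneousComponent_of_mem hge, if_pos rfl] at this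

theorem isHomogeneous_initialIdeal (hI : I.IsHomogeneous (homogeneousSubmodule (Fin n) K))
    (ω : Fin n → ℝ) : (initialIdeal ω I).IsHomogeneous (homogeneousSubmodule (Fin n) K) := by
  intro e g hg
  have h : ((DirectSum.decompose (homogeneousSubmodule (Fin n) K) g) e : MvPolynomial (Fin n) K) =
      homogeneousComponent e g := decomposition.decompose'_apply g e
  rw [h]
  exact (mem_homogeneousPart.1 (initialSpan_homogeneousPart_le I e
    (homogeneousComponent_mem_initialSpan hI hg e))).1

theorem hilbertFunction_initialIdeal (hI : I.IsHomogeneous (homogeneousSubmodule (Fin n) K))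
    (ω : Fin n → ℝ) (e : ℕ) : hilbertFunction (initialIdeal ω I) e = hilbertFunction I e := by
  rw [hilbertFunction, homogeneousPart_initialIdeal hI,
    finrank_initialSpan (hasFiniteSupport_homogeneousPart I e), hilbertFunction]

theorem truncation_le (I : Ideal (MvPolynomial (Fin n) K)) (d : ℕ) :
    truncation I d ≤ I.restrictScalars K :=
  iSup₂_le fun _ _ => inf_le_left

theorem homogeneousPart_le_truncation (I : Ideal (MvPolynomial (Fin n) K)) {e : ℕ} (h : e ≤ d) :
    homogeneousPart I e ≤ truncation I d :=
  le_iSup₂_of_le (f := fun (j : ℕ) (_ : j ≤ d) => homogeneousPart I j) e h le_rfl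

/-- An element of the truncation supported in degree `e` lies in `I_e`, and a smaller support stays
in degree `e`, so minimality means the same in both spaces. -/
theorem circuits_homogeneousPart (I : Ideal (MvPolynomial (Fin n) K)) {e : ℕ} (h : e ≤ d) :
    circuits (homogeneousPart I e : Set (MvPolynomial (Fin n) K)) =
      {C ∈ circuits (truncation I d : Set (MvPolynomial (Fin n) K)) | ∀ a ∈ C, a.degree = e} := by
  have hmem : ∀ f ∈ truncation I d, (∀ a ∈ f.support, a.degree = e) → f ∈ homogeneousPart I e :=
    fun f hf hfe => mem_homogeneousPart.2
      ⟨truncation_le I d hf, isHomogeneous_of_forall_degree hfe⟩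
  ext C
  constructor
  · rintro ⟨⟨f, hf, hf0, rfl⟩, hmin⟩
    have hdeg : ∀ a ∈ f.support, a.degree = e := fun a ha =>
      degree_eq_of_mem_support (mem_homogeneousPart.1 hf).2 ha
    refine ⟨⟨⟨f, homogeneousPart_le_truncation I h hf, hf0, rfl⟩, ?_⟩, hdeg⟩
    rintro _ ⟨g, hg, hg0, rfl⟩ hgf
    exact hmin ⟨g, hmem g hg fun a ha => hdeg a (hgf ha), hg0, rfl⟩ hgf
  · rintro ⟨⟨⟨f, hf, hf0, rfl⟩, hmin⟩, hdeg⟩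
    refine ⟨⟨f, hmem f hf hdeg, hf0, rfl⟩, ?_⟩
    rintro _ ⟨g, hg, hg0, rfl⟩ hgf
    exact hmin ⟨g, homogeneousPart_le_truncation I h hg, hg0, rfl⟩ hgf

theorem initialIdeal_le_of_circuits_eq (hI : I.IsHomogeneous (homogeneousSubmodule (Fin n) K))
    (hJ : J.IsHomogeneous (homogeneousSubmodule (Fin n) K))
    (hJL : ∀ e, hilbertFunction J e = hilbertFunction L e)
    (hd : ∀ a ∈ minimalGenerators (lexSegmentIdeal L), a.degree ≤ d)
    (hcs : circuits (truncation I d : Set (MvPolynomial (Fin n) K)) =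
      circuits (truncation J d : Set (MvPolynomial (Fin n) K)))
    (h : initialIdeal ω I = initialIdeal ω' I) : initialIdeal ω J ≤ initialIdeal ω' J := by
  refine le_of_homogeneousPart_le (isHomogeneous_initialIdeal hJ ω)
    (homogeneousPart_le_of_forall_le
      (fun e => (hilbertFunction_initialIdeal hJ ω e).trans (hJL e)) hd fun e he => ?_)
  rw [homogeneousPart_initialIdeal hJ, homogeneousPart_initialIdeal hJ]
  refine (initialSpan_eq_of_circuits_eq (hasFiniteSupport_homogeneousPart I e)
    (hasFiniteSupport_homogeneousPart J e) ?_ ?_).le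
  · rw [circuits_homogeneousPart I he, circuits_homogeneousPart J he, hcs]
  · rw [← homogeneousPart_initialIdeal hI, ← homogeneousPart_initialIdeal hI, h]

end InitialIdeals

end CircuitSets

theorem corollary2p11 {K : Type*} [Field K] {n : ℕ}
    (I J : Ideal (MvPolynomial (Fin n) K))
    (hI : I.IsHomogeneous (MvPolynomial.homogeneousSubmodule (Fin n) K))
    (hJ : J.IsHomogeneous (MvPolynomial.homogeneousSubmodule (Fin n) K))
    (hIJ : ∀ e : ℕ, CircuitSets.hilbertFunction I e = CircuitSets.hilbertFunction J e)
    (d : ℕ)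
    (hd : IsLUB {e : ℕ | ∃ a ∈ CircuitSets.minimalGenerators (CircuitSets.lexSegmentIdeal I),
      a.degree = e} d)
    (hcs : CircuitSets.circuits (CircuitSets.truncation I d : Set (MvPolynomial (Fin n) K)) =
      CircuitSets.circuits (CircuitSets.truncation J d : Set (MvPolynomial (Fin n) K))) :
    CircuitSets.groebnerFan I = CircuitSets.groebnerFan J := by
  have hd' : ∀ a ∈ CircuitSets.minimalGenerators (CircuitSets.lexSegmentIdeal I),
      a.degree ≤ d := fun a ha => hd.1 ⟨a, ha, rfl⟩
  -- The equivalence classes of weights, and with them their closures, agree for `I` and `J`. Both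
  -- directions compare Hilbert functions with that of `I`, whose lex-segment ideal defines `d`.
  have hiff : ∀ ω ω' : Fin n → ℝ,
      CircuitSets.initialIdeal ω' I = CircuitSets.initialIdeal ω I ↔
        CircuitSets.initialIdeal ω' J = CircuitSets.initialIdeal ω J := by
    refine fun ω ω' => ⟨fun h => ?_, fun h => ?_⟩
    · have key := fun ω ω' => CircuitSets.initialIdeal_le_of_circuits_eq (ω := ω) (ω' := ω') hI hJ
        (fun e => (hIJ e).symm) hd' hcs
      exact le_antisymm (key ω' ω h) (key ω ω' h.symm)
    · have key := fun ω ω' => CircuitSets.initialIdeal_le_of_circuits_eq (ω := ω) (ω' := ω') hJ hI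
        (fun _ => rfl) hd' hcs.symm
      exact le_antisymm (key ω' ω h) (key ω ω' h.symm)
  simp only [CircuitSets.groebnerFan, hiff]
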